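/- Let $M$ be a Kähler manifold of real dimension $2m$, i.e. a complex manifold of complex dimension $m$, with complex structure tensor $J$, and a smooth Riemannian metric $g$ such that $g(Jv,Jw)=g(v,w)$ and $\nabla J=0$, where $\nabla$ is the Levi-Civita connection of $g$. Smooth real local coordinates $(x_1,\dots,x_{2m})$ are called orthogonal if $g(\partial/\partial x_i,\partial/\partial x_j)=0$ for $i\ne j$; one then sets $a_i=\sqrt{g(\partial/\partial x_i,\partial/\partial x_i)}>0$ and $e_i=\frac1{a_i}\frac{\partial}{\partial x_i}$. They are called unitary if in addition $Je_{2k+1}=e_{2k+2}$ and $Je_{2k+2}=-e_{2k+1}$ for $k=0,\dots,m-1$. (1) In any orthogonal coordinates on an open subset of $M$ that are unitary, for each $k$ the coefficients $a_{2k+1}$ and $a_{2k+2}$ depend only on $(x_{2k+1},x_{2k+2})$, in the following sense: on every convex subset of the coordinate domain in $\mathbb{R}^{2m}$ they take equal values at any two points with the same $x_{2k+1}$ and $x_{2k+2}$ (in particular this holds near every point). (2) If every point of $M$ has a neighborhood with orthogonal coordinates that are unitary, then $M$ is locally a Riemannian product of Riemann surfaces: every point of $M$ has an open neighborhood $U$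 for which there are Riemann surfaces $S_1,\dots,S_m$ with smooth Riemannian metrics $g_1,\dots,g_m$ compatible with their complex structures, and a diffeomorphism $\Phi=(\Phi_1,\dots,\Phi_m):U\to S_1\times\cdots\times S_m$ with each $\Phi_k$ holomorphic, such that $g=\sum_{k=1}^m\Phi_k^*g_k$ on $U$. -/

import Mathlib

open scoped Manifold ContDiff Bundle Topology

noncomputable section

namespace KahlerOrthogonal

section ComplexManifold

variable {E : Type*} [NormedAddCommGroup E] [NormedSpace ℂ E]

/-- A complex manifold (charts in the complex vector space `E`, holomorphic transition maps) is in
particular a real manifold, with the same charts and of every order of smoothness. -/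
instance isManifold_real {M : Type*} [TopologicalSpace M] [ChartedSpace E M]
    [h : IsManifold 𝓘(ℂ, E) ω M] (n : ℕ∞ω) : IsManifold 𝓘(ℝ, E) n M := by
  have : IsManifold 𝓘(ℝ, E) ω M := by
    apply isManifold_of_contDiffOn
    intro e e' he he'
    have h1 := (contDiffGroupoid ω 𝓘(ℂ, E)).compatible he he'
    rw [contDiffGroupoid, mem_groupoid_of_pregroupoid] at h1
    exact ContDiffOn.restrict_scalars ℝ (h1.1 : ContDiffOn ℂ ω _ _)
  exact IsManifold.of_le (m := n) (n := ω) le_top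

/-- The complex structure tensor `J` of a complex manifold: multiplication by `i` on each (real)
tangent space. Mathlib identifies the tangent space at `x` with `E` through the preferred
holomorphic chart at `x`; as transition maps are holomorphic, any other holomorphic chart gives the
same endomorphism. -/
def complexJ {M : Type*} [TopologicalSpace M] [ChartedSpace E M] (x : M) :
    TangentSpace 𝓘(ℝ, E) x →L[ℝ] TangentSpace 𝓘(ℝ, E) x :=
  (Complex.I • ContinuousLinearMap.id ℝ E : E →L[ℝ] E)

variable (E) in
/-- Smooth Riemannian metrics on (the real manifold underlying) a complex manifold. -/
abbrev SmoothMetric (M : Type*) [TopologicalSpace M] [ChartedSpace E M]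
    [IsManifold 𝓘(ℂ, E) ω M] :=
  Bundle.ContMDiffRiemannianMetric 𝓘(ℝ, E) ∞ E (fun x : M => TangentSpace 𝓘(ℝ, E) x)

variable {M : Type*} [TopologicalSpace M] [ChartedSpace E M] [IsManifold 𝓘(ℂ, E) ω M]

/-- `J` acts by isometries on each tangent space. -/
def IsHermitian (g : SmoothMetric E M) : Prop :=
  ∀ (x : M) (v w : TangentSpace 𝓘(ℝ, E) x),
    g.inner x (complexJ x v) (complexJ x w) = g.inner x v w

/-- The vector field `Y` is differentiable at `x`. -/
def VFDiffAt (Y : Π x : M, TangentSpace 𝓘(ℝ, E) x) (x : M) : Prop :=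
  MDifferentiableAt 𝓘(ℝ, E) 𝓘(ℝ, E).tangent
    (fun y => (⟨y, Y y⟩ : TangentBundle 𝓘(ℝ, E) M)) x

/-- `D` is the Levi-Civita connection of `g`: it is metric,
`v ⟨Y, Z⟩ = ⟨∇_v Y, Z⟩ + ⟨Y, ∇_v Z⟩`, and torsion-free.
Here `D Y x v` is the covariant derivative of the vector field `Y` in the direction `v ∈ T_x M`. -/
structure IsLeviCivita [FiniteDimensional ℂ E] (g : SmoothMetric E M)
    (D : CovariantDerivative 𝓘(ℝ, E) E (fun x : M => TangentSpace 𝓘(ℝ, E) x)) : Prop where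
  metric : ∀ (Y Z : Π x : M, TangentSpace 𝓘(ℝ, E) x) (x : M), VFDiffAt Y x → VFDiffAt Z x →
    ∀ v : TangentSpace 𝓘(ℝ, E) x,
      mvfderiv 𝓘(ℝ, E) (fun y => g.inner y (Y y) (Z y)) x v
        = g.inner x (D Y x v) (Z x) + g.inner x (Y x) (D Z x v)
  torsion_free : D.torsion = 0

/-- `g` is a Kähler metric: it is Hermitian, and `J` is parallel for the Levi-Civita connection,
`∇_v (J Y) = J (∇_v Y)`. -/
structure IsKahler [FiniteDimensional ℂ E] (g : SmoothMetric E M) : Prop where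
  hermitian : IsHermitian g
  parallel : ∃ D : CovariantDerivative 𝓘(ℝ, E) E (fun x : M => TangentSpace 𝓘(ℝ, E) x),
    IsLeviCivita g D ∧
      ∀ (Y : Π x : M, TangentSpace 𝓘(ℝ, E) x) (x : M), VFDiffAt Y x →
        ∀ v : TangentSpace 𝓘(ℝ, E) x,
          D (fun y => complexJ y (Y y)) x v = complexJ x (D Y x v)

/-! ### Orthogonal coordinates -/

/-- The coordinate space `ℝⁿ`. -/
abbrev Coord (n : ℕ) := EuclideanSpace ℝ (Fin n)

/-- `φ` is a smooth real coordinate chart of `M`, on the open set `φ.source`. -/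
structure IsSmoothChart {n : ℕ} (φ : OpenPartialHomeomorph M (Coord n)) : Prop where
  smooth : ContMDiffOn 𝓘(ℝ, E) 𝓘(ℝ, Coord n) ∞ φ φ.source
  smooth_symm : ContMDiffOn 𝓘(ℝ, Coord n) 𝓘(ℝ, E) ∞ φ.symm φ.target

variable (E) in
/-- The coordinate vector field `∂/∂x_i` of the chart `φ`, at the point with coordinates `y`. -/
def coordField {n : ℕ} (φ : OpenPartialHomeomorph M (Coord n)) (i : Fin n) (y : Coord n) :
    TangentSpace 𝓘(ℝ, E) (φ.symm y) :=
  mfderiv 𝓘(ℝ, Coord n) 𝓘(ℝ, E) φ.symm y (EuclideanSpace.single i (1 : ℝ) : Coord n)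

/-- The coordinates of the chart `φ` are orthogonal. -/
structure IsOrthogonalChart {n : ℕ} (g : SmoothMetric E M)
    (φ : OpenPartialHomeomorph M (Coord n)) : Prop where
  isSmoothChart : IsSmoothChart (E := E) φ
  orthogonal : ∀ y ∈ φ.target, ∀ i j : Fin n, i ≠ j →
    g.inner (φ.symm y) (coordField E φ i y) (coordField E φ j y) = 0

/-- The coefficient `a_i = √⟨∂/∂x_i, ∂/∂x_i⟩`, as a function of the coordinates. -/
def coeff {n : ℕ} (g : SmoothMetric E M) (φ : OpenPartialHomeomorph M (Coord n)) (i : Fin n)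
    (y : Coord n) : ℝ :=
  √(g.inner (φ.symm y) (coordField E φ i y) (coordField E φ i y))

/-- The associated frame `e_i = (1 / a_i) ∂/∂x_i`, at the point with coordinates `y`. -/
def frame {n : ℕ} (g : SmoothMetric E M) (φ : OpenPartialHomeomorph M (Coord n)) (i : Fin n)
    (y : Coord n) : TangentSpace 𝓘(ℝ, E) (φ.symm y) :=
  (coeff g φ i y)⁻¹ • coordField E φ i y

/-- The first index of the `k`-th pair (`2k+1` when indices start from `1`). -/
def fstIdx {m : ℕ} (k : Fin m) : Fin (2 * m) := ⟨2 * k, by omega⟩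

/-- The second index of the `k`-th pair (`2k+2` when indices start from `1`). -/
def sndIdx {m : ℕ} (k : Fin m) : Fin (2 * m) := ⟨2 * k + 1, by omega⟩

/-- The coordinates of the chart `φ` are orthogonal, and their associated frame is unitary:
`J e_{2k+1} = e_{2k+2}` and `J e_{2k+2} = - e_{2k+1}`. -/
structure IsUnitaryOrthogonalChart {m : ℕ} (g : SmoothMetric E M)
    (φ : OpenPartialHomeomorph M (Coord (2 * m))) : Prop where
  isOrthogonalChart : IsOrthogonalChart g φ
  map_fst : ∀ y ∈ φ.target, ∀ k : Fin m,
    complexJ (φ.symm y) (frame g φ (fstIdx k) y) = frame g φ (sndIdx k) y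
  map_snd : ∀ y ∈ φ.target, ∀ k : Fin m,
    complexJ (φ.symm y) (frame g φ (sndIdx k) y) = -frame g φ (fstIdx k) y

/-- Every point of `M` has a neighborhood with unitary orthogonal coordinates. -/
def SupportsUnitaryOrthogonalCoordinates (m : ℕ) (g : SmoothMetric E M) : Prop :=
  ∀ p : M, ∃ φ : OpenPartialHomeomorph M (Coord (2 * m)),
    p ∈ φ.source ∧ IsUnitaryOrthogonalChart g φ

/-- On every convex part of the coordinate domain of `φ`, the function `f` depends only on the
`k`-th pair of coordinates. (As balls are convex, this is so around every point of the domain.) -/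
def DependsOnlyOnPair {m : ℕ} (φ : OpenPartialHomeomorph M (Coord (2 * m))) (k : Fin m)
    (f : Coord (2 * m) → ℝ) : Prop :=
  ∀ V : Set (Coord (2 * m)), Convex ℝ V → V ⊆ φ.target → ∀ y ∈ V, ∀ z ∈ V,
    y (fstIdx k) = z (fstIdx k) → y (sndIdx k) = z (sndIdx k) → f y = f z

end ComplexManifold

/-! ### Products of Riemann surfaces -/

/-- A Riemann surface (connected Hausdorff complex manifold of complex dimension one) with a smooth
Riemannian metric compatible with its complex structure. -/
structure MetricRiemannSurface where
  carrier : Type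
  [topologicalSpace : TopologicalSpace carrier]
  [t2Space : T2Space carrier]
  [connectedSpace : ConnectedSpace carrier]
  [chartedSpace : ChartedSpace ℂ carrier]
  [isManifold : IsManifold 𝓘(ℂ, ℂ) ω carrier]
  metric : SmoothMetric ℂ carrier
  hermitian : IsHermitian metric

attribute [instance] MetricRiemannSurface.topologicalSpace MetricRiemannSurface.t2Space
  MetricRiemannSurface.connectedSpace MetricRiemannSurface.chartedSpace
  MetricRiemannSurface.isManifold

section Product

variable {E : Type*} [NormedAddCommGroup E] [NormedSpace ℂ E]
  {M : Type*} [TopologicalSpace M] [ChartedSpace E M] [IsManifold 𝓘(ℂ, E) ω M]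

/-- `Φ` identifies the open set `Φ.source` of `M` with the whole Riemannian product of the Riemann
surfaces `S k`: it is a homeomorphism onto the product, its components `Φ_k` are holomorphic (complex
differentiable, hence smooth), and `g` is the product metric, `g = ∑ k, Φ_k^* g_k`. As `g` is
positive definite, `Φ` is then a diffeomorphism onto the product. -/
structure IsProductIsometry {m : ℕ} (g : SmoothMetric E M) (S : Fin m → MetricRiemannSurface)
    (Φ : OpenPartialHomeomorph M (Π k, (S k).carrier)) : Prop where
  target_eq : Φ.target = Set.univ
  holomorphic : ∀ k, MDifferentiableOn 𝓘(ℂ, E) 𝓘(ℂ, ℂ) (fun q => Φ q k) Φ.source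
  isometry : ∀ q ∈ Φ.source, ∀ v w : TangentSpace 𝓘(ℝ, E) q,
    g.inner q v w = ∑ k, (S k).metric.inner (Φ q k)
      (mfderiv 𝓘(ℝ, E) 𝓘(ℝ, ℂ) (fun q' => Φ q' k) q v)
      (mfderiv 𝓘(ℝ, E) 𝓘(ℝ, ℂ) (fun q' => Φ q' k) q w)

/-- `M` is locally a Riemannian product of `m` Riemann surfaces. -/
def IsLocallyProductOfRiemannSurfaces (m : ℕ) (g : SmoothMetric E M) : Prop :=
  ∀ p : M, ∃ (S : Fin m → MetricRiemannSurface)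
    (Φ : OpenPartialHomeomorph M (Π k, (S k).carrier)), p ∈ Φ.source ∧ IsProductIsometry g S Φ

end Product

end KahlerOrthogonal

end

set_option autoImplicit false

noncomputable section

/-! Write `∂_i` for the coordinate fields and `a_i` for their lengths. In orthogonal coordinates
`⟨∇_{∂_i} ∂_j, ∂_l⟩` is symmetric in `i, j` and skew in `j, l`, so it vanishes for three distinct
indices (`IsLeviCivita.inner_eq_zero`). Let `i, i'` be one pair and `j, j'` another, with `J ∂_j = σ
∂_{j'}` and `J ∂_i = τ ∂_{i'}`. Pairing `∇_{∂_i}(J ∂_j) = J ∇_{∂_i} ∂_j` with `∂_i` gives `σ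
⟨∇_{∂_i} ∂_{j'}, ∂_i⟩` on the left and `-τ ⟨∇_{∂_i} ∂_j, ∂_{i'}⟩ = 0` on the right. Hence
`∂_{j'}(a_i²) = 0` (`mvfderiv_inner_eq_zero`), and integrating along segments gives (1).

For (2), the metric already splits as a sum over pairs, each term living on a plane. What remains is
a holomorphic coordinate on each plane, and no existence theorem for isothermal coordinates is
needed: the complex structure of `M` supplies one. Since `J` preserves each pair, a complex linear
functional of a holomorphic chart, restricted to the `k`-th coordinate slice, is a function `W` with
`i W_x = ρ W_y`, where `ρ` is the ratio of the two coefficients. Where `W_x ≠ 0` it is a local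
diffeomorphism carrying the metric of the slice to a conformal metric on a disc
(`exists_conformal_chart`, `IsUnitaryOrthogonalChart.exists_factor`). By (1), `ρ` and the
coefficients at any nearby point agree with those on the slice, so these maps, extended
independently of the other pairs, are holomorphic on `M` and together isometric
(`IsUnitaryOrthogonalChart.exists_productIsometry`). -/

namespace KahlerOrthogonal

/-! ### Discs with conformal metrics as Riemann surfaces -/

/-- The open disc with center `c` and radius `r`, as a type. -/
structure Disc (c : ℂ) (r : ℝ) : Type where
  val : ℂ
  mem : val ∈ Metric.ball c r

namespace Disc

variable {c : ℂ} {r : ℝ}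

instance : TopologicalSpace (Disc c r) := TopologicalSpace.induced Disc.val inferInstance

theorem val_injective : Function.Injective (Disc.val : Disc c r → ℂ) := by
  rintro ⟨a, ha⟩ ⟨b, hb⟩ h
  cases h
  rfl

theorem range_val : Set.range (Disc.val : Disc c r → ℂ) = Metric.ball c r := by
  ext z
  exact ⟨fun ⟨x, hx⟩ => hx ▸ x.mem, fun hz => ⟨⟨z, hz⟩, rfl⟩⟩

theorem isOpenEmbedding_val : Topology.IsOpenEmbedding (Disc.val : Disc c r → ℂ) where
  eq_induced := rfl
  injective := val_injective
  isOpen_range := by rw [range_val]; exact Metric.isOpen_ball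

instance : T2Space (Disc c r) := isOpenEmbedding_val.isEmbedding.t2Space

variable [hr : Fact (0 < r)]

instance : Nonempty (Disc c r) := ⟨⟨c, Metric.mem_ball_self hr.out⟩⟩

instance : ConnectedSpace (Disc c r) := by
  have h : IsConnected (Disc.val '' (Set.univ : Set (Disc c r))) := by
    rw [Set.image_univ, range_val]
    exact ⟨⟨c, Metric.mem_ball_self hr.out⟩, (convex_ball c r).isPreconnected⟩
  have : PreconnectedSpace (Disc c r) :=
    ⟨isOpenEmbedding_val.isInducing.isPreconnected_image.1 h.isPreconnected⟩
  exact { toNonempty := inferInstance }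

instance : ChartedSpace ℂ (Disc c r) := isOpenEmbedding_val.singletonChartedSpace

instance : IsManifold 𝓘(ℂ, ℂ) ω (Disc c r) := isOpenEmbedding_val.isManifold_singleton

theorem contMDiff_val : ContMDiff 𝓘(ℝ, ℂ) 𝓘(ℝ, ℂ) ∞ (Disc.val : Disc c r → ℂ) :=
  contMDiff_isOpenEmbedding isOpenEmbedding_val

/-- The disc has a single chart, so every coordinate change of its tangent bundle is the identity.
Smoothness of a metric thus reduces to smoothness of its coefficient. -/
theorem trivializationAt_symm (x z : Disc c r) (v : ℂ) :
    (trivializationAt ℂ (TangentSpace 𝓘(ℝ, ℂ)) x).symm z v = v := by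
  have h := congrArg (fun L : ℂ →L[ℝ] ℂ => L v)
    (TangentBundle.symmL_trivializationAt_eq_core (I := 𝓘(ℝ, ℂ)) (b₀ := x) (b := z)
      (Set.mem_univ z))
  refine (Bundle.Trivialization.symmL_apply _ (Set.mem_univ z) v).symm.trans (h.trans ?_)
  exact (tangentBundleCore 𝓘(ℝ, ℂ) (Disc c r)).coordChange_self (achart ℂ z) z
    (mem_achart_source ℂ z) v

theorem isVonNBounded_conformal {a : ℝ} (ha : 0 < a) :
    Bornology.IsVonNBounded ℝ {v : ℂ | a * inner ℝ v v < 1} := by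
  apply (NormedSpace.isVonNBounded_ball ℝ ℂ (√a⁻¹)).subset
  intro v hv
  have h : a * inner ℝ v v < 1 := hv
  rw [mem_ball_zero_iff]
  apply Real.lt_sqrt_of_sq_lt
  rw [real_inner_self_eq_norm_sq] at h
  rw [inv_eq_one_div, lt_div_iff₀ ha]
  linarith

/-- The Euclidean inner product of `ℂ`, as a bilinear form. -/
def innerForm : ℂ →L[ℝ] ℂ →L[ℝ] ℝ := innerSL ℝ

/-- The inner product `a(z) |dz|²` on the tangent space of the disc at `z`. -/
def conformalInner (a : ℂ → ℝ) (x : Disc c r) :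
    TangentSpace 𝓘(ℝ, ℂ) x →L[ℝ] TangentSpace 𝓘(ℝ, ℂ) x →L[ℝ] ℝ :=
  (a x.val • innerForm : ℂ →L[ℝ] ℂ →L[ℝ] ℝ)

theorem contMDiff_conformalInner {a : ℂ → ℝ} (ha : ContDiffOn ℝ ∞ a (Metric.ball c r)) :
    ContMDiff 𝓘(ℝ, ℂ) (𝓘(ℝ, ℂ).prod 𝓘(ℝ, ℂ →L[ℝ] ℂ →L[ℝ] ℝ)) ∞
      (fun x : Disc c r => Bundle.TotalSpace.mk' (ℂ →L[ℝ] ℂ →L[ℝ] ℝ)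
        (E := fun x : Disc c r => TangentSpace 𝓘(ℝ, ℂ) x →L[ℝ] TangentSpace 𝓘(ℝ, ℂ) x →L[ℝ] ℝ)
        x (conformalInner a x)) := by
  intro x
  rw [Bundle.contMDiffAt_section]
  have h₁ : ContMDiffAt 𝓘(ℝ, ℂ) 𝓘(ℝ, ℝ) ∞ (fun x : Disc c r => a x.val) x :=
    (ha.contDiffAt (Metric.isOpen_ball.mem_nhds x.mem)).contMDiffAt.comp x
      contMDiff_val.contMDiffAt
  have h₂ : ContMDiffAt 𝓘(ℝ, ℂ) 𝓘(ℝ, ℂ →L[ℝ] ℂ →L[ℝ] ℝ) ∞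
      (fun x : Disc c r => a x.val • innerForm) x :=
    h₁.smul (contMDiffAt_const (c := innerForm))
  refine h₂.congr_of_eventuallyEq (Filter.Eventually.of_forall fun z => ?_)
  ext v w
  simp [hom_trivializationAt_apply, ContinuousLinearMap.inCoordinates]
  exact congrArg₂ (fun v w : ℂ => a z.val * innerForm v w) (trivializationAt_symm x z v)
    (trivializationAt_symm x z w)

/-- The conformal metric `a(z) |dz|²` on the disc. -/
def conformalMetric (a : ℂ → ℝ) (ha : ContDiffOn ℝ ∞ a (Metric.ball c r))
    (hpos : ∀ z ∈ Metric.ball c r, 0 < a z) : SmoothMetric ℂ (Disc c r) where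
  inner := conformalInner a
  symm x v w := congrArg (a x.val * ·) (real_inner_comm (F := ℂ) w v)
  pos x v hv := mul_pos (hpos _ x.mem) ((real_inner_self_pos (F := ℂ) (x := v)).2 hv)
  isVonNBounded x := isVonNBounded_conformal (hpos _ x.mem)
  contMDiff := contMDiff_conformalInner ha

end Disc

namespace Disc
variable {c : ℂ} {r : ℝ} [hr : Fact (0 < r)]

theorem innerForm_apply (v w : ℂ) : innerForm v w = v.re * w.re + v.im * w.im := by
  rw [innerForm, innerSL_apply_apply, Complex.inner, Complex.mul_re, Complex.conj_re,
    Complex.conj_im]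
  ring

/-- The disc with the conformal metric `a(z) |dz|²`, as a Riemann surface. -/
def conformalSurface (c : ℂ) (r : ℝ) [hr : Fact (0 < r)] (a : ℂ → ℝ)
    (ha : ContDiffOn ℝ ∞ a (Metric.ball c r))
    (hpos : ∀ z ∈ Metric.ball c r, 0 < a z) : MetricRiemannSurface where
  carrier := Disc c r
  metric := conformalMetric a ha hpos
  hermitian x v w := by
    have h : ∀ v w : ℂ, innerForm (Complex.I * v) (Complex.I * w) = innerForm v w := by
      intro v w
      simp only [innerForm_apply, Complex.mul_re, Complex.mul_im, Complex.I_re, Complex.I_im]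
      ring
    exact congrArg (a x.val * ·) (h v w)

/-- The only chart of the disc is `Disc.val`, so both maps have the same expression in charts; only
continuity has to be transferred. -/
theorem hasMFDerivAt_of_val_comp {𝕜 : Type*} [NontriviallyNormedField 𝕜] [NormedSpace 𝕜 ℂ]
    {E : Type*} [NormedAddCommGroup E] [NormedSpace 𝕜 E]
    {M : Type*} [TopologicalSpace M] [ChartedSpace E M] {f : M → Disc c r} {x : M}
    {f' : E →L[𝕜] ℂ}
    (h : HasMFDerivAt 𝓘(𝕜, E) 𝓘(𝕜, ℂ) (fun q => (f q).val) x f') :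
    HasMFDerivAt 𝓘(𝕜, E) 𝓘(𝕜, ℂ) f x f' :=
  ⟨isOpenEmbedding_val.isInducing.continuousAt_iff.2 h.1, h.2⟩

end Disc

/-! ### Real versus complex differentiability -/

section RestrictScalars

variable {E F : Type*} [NormedAddCommGroup E] [NormedSpace ℂ E]
  [NormedAddCommGroup F] [NormedSpace ℂ F]
  {M : Type*} [TopologicalSpace M] [ChartedSpace E M]
  {N : Type*} [TopologicalSpace N] [ChartedSpace F N]

theorem hasMFDerivAt_real_of_complex {f : M → N} {x : M} {f' : E →L[ℂ] F}
    (h : HasMFDerivAt 𝓘(ℂ, E) 𝓘(ℂ, F) f x f') :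
    HasMFDerivAt 𝓘(ℝ, E) 𝓘(ℝ, F) f x (f'.restrictScalars ℝ) :=
  ⟨h.1, HasFDerivWithinAt.restrictScalars ℝ h.2⟩

theorem hasMFDerivAt_complex_of_real {f : M → N} {x : M} {f' : E →L[ℂ] F}
    (h : HasMFDerivAt 𝓘(ℝ, E) 𝓘(ℝ, F) f x (f'.restrictScalars ℝ)) :
    HasMFDerivAt 𝓘(ℂ, E) 𝓘(ℂ, F) f x f' := by
  refine ⟨h.1, ?_⟩
  have h2 := h.2
  simp only [mfld_simps] at h2 ⊢
  exact (hasFDerivAt_of_restrictScalars ℝ (hasFDerivWithinAt_univ.1 h2) rfl).hasFDerivWithinAt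

/-- Cauchy–Riemann: a real-linear differential that commutes with multiplication by `i` is complex
linear. -/
theorem mdifferentiableAt_complex_of_real {f : M → N} {x : M}
    (h : MDifferentiableAt 𝓘(ℝ, E) 𝓘(ℝ, F) f x)
    (hJ : ∀ v, mfderiv 𝓘(ℝ, E) 𝓘(ℝ, F) f x (complexJ x v) =
      complexJ (f x) (mfderiv 𝓘(ℝ, E) 𝓘(ℝ, F) f x v)) :
    MDifferentiableAt 𝓘(ℂ, E) 𝓘(ℂ, F) f x := by
  let L : E →L[ℝ] F := mfderiv 𝓘(ℝ, E) 𝓘(ℝ, F) f x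
  have hL : ∀ v : E, L (Complex.I • v) = Complex.I • L v := hJ
  have hL' : ∀ (a : ℝ) (v : E), L ((a : ℂ) • v) = (a : ℂ) • L v := fun a v => by simp
  let L' : E →L[ℂ] F :=
    { toFun := L
      map_add' := L.map_add
      map_smul' := fun z v => by
        simp only [RingHom.id_apply]
        rw [← Complex.re_add_im z, add_smul, add_smul, map_add, mul_smul, mul_smul, hL', hL', hL]
      cont := L.cont }
  exact (hasMFDerivAt_complex_of_real (f' := L') h.hasMFDerivAt).mdifferentiableAt

theorem mfderiv_complexJ {f : M → N} {x : M} (h : MDifferentiableAt 𝓘(ℂ, E) 𝓘(ℂ, F) f x)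
    (v : TangentSpace 𝓘(ℝ, E) x) :
    mfderiv 𝓘(ℝ, E) 𝓘(ℝ, F) f x (complexJ x v) =
      complexJ (f x) (mfderiv 𝓘(ℝ, E) 𝓘(ℝ, F) f x v) := by
  have h1 := (hasMFDerivAt_real_of_complex h.hasMFDerivAt).mfderiv
  rw [h1]
  exact (mfderiv 𝓘(ℂ, E) 𝓘(ℂ, F) f x : E →L[ℂ] F).map_smul Complex.I v

end RestrictScalars

/-! ### Coordinate vector fields on the manifold -/

section ChartFields

variable {E : Type*} [NormedAddCommGroup E] [NormedSpace ℂ E]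
  {M : Type*} [TopologicalSpace M] [ChartedSpace E M]
  {n : ℕ} {φ : OpenPartialHomeomorph M (Coord n)}

theorem IsSmoothChart.mdifferentiable (hφ : IsSmoothChart (E := E) φ) :
    φ.MDifferentiable 𝓘(ℝ, E) 𝓘(ℝ, Coord n) :=
  ⟨hφ.smooth.mdifferentiableOn (by simp), hφ.smooth_symm.mdifferentiableOn (by simp)⟩

/-- The constant vector field in the `i`-th coordinate direction. -/
def constField (n : ℕ) (i : Fin n) (y : Coord n) : TangentSpace 𝓘(ℝ, Coord n) y :=
  (EuclideanSpace.single i (1 : ℝ) : Coord n)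

theorem contMDiff_constField (n : ℕ) (i : Fin n) (k : ℕ∞ω) :
    ContMDiff 𝓘(ℝ, Coord n) 𝓘(ℝ, Coord n).tangent k
      (fun y => (⟨y, constField n i y⟩ : TangentBundle 𝓘(ℝ, Coord n) (Coord n))) :=
  contMDiff_vectorSpace_iff_contDiff.2 contDiff_const

theorem mlieBracket_constField {n : ℕ} (i j : Fin n) (y : Coord n) :
    VectorField.mlieBracket 𝓘(ℝ, Coord n) (constField n i) (constField n j) y = 0 := by
  rw [← VectorField.mlieBracketWithin_univ, VectorField.mlieBracketWithin_eq_lieBracketWithin]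
  have h : ∀ v w : Coord n,
      VectorField.lieBracketWithin ℝ (fun _ : Coord n => v) (fun _ => w) Set.univ y = 0 := by
    intro v w
    simp [VectorField.lieBracketWithin]
  exact h _ _

open Classical in
variable (E) in
/-- The coordinate vector field `∂/∂x_i` of the chart `φ` on `M`, extended by zero. -/
def chartField (φ : OpenPartialHomeomorph M (Coord n)) (i : Fin n) (x : M) :
    TangentSpace 𝓘(ℝ, E) x :=
  if x ∈ φ.source then
    VectorField.mpullback 𝓘(ℝ, E) 𝓘(ℝ, Coord n) φ (constField n i) x
  else 0

theorem IsSmoothChart.inverse_mfderiv (hφ : IsSmoothChart (E := E) φ) {y : Coord n}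
    (hy : y ∈ φ.target) :
    (mfderiv 𝓘(ℝ, E) 𝓘(ℝ, Coord n) φ (φ.symm y)).inverse =
      mfderiv 𝓘(ℝ, Coord n) 𝓘(ℝ, E) φ.symm y := by
  have h1 := hφ.mdifferentiable.comp_symm_deriv hy
  have h2 := hφ.mdifferentiable.symm_comp_deriv (φ.map_target hy)
  rw [φ.right_inv hy] at h2
  exact ContinuousLinearMap.inverse_eq h1 h2

theorem chartField_symm (hφ : IsSmoothChart (E := E) φ) (i : Fin n) {y : Coord n}
    (hy : y ∈ φ.target) : chartField E φ i (φ.symm y) = coordField E φ i y := by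
  rw [chartField, if_pos (φ.map_target hy), VectorField.mpullback_apply, hφ.inverse_mfderiv hy]
  rfl

theorem IsSmoothChart.isInvertible_mfderiv (hφ : IsSmoothChart (E := E) φ) {x : M}
    (hx : x ∈ φ.source) : (mfderiv 𝓘(ℝ, E) 𝓘(ℝ, Coord n) φ x).IsInvertible :=
  ⟨hφ.mdifferentiable.mfderiv hx, rfl⟩

theorem chartField_eventuallyEq (i : Fin n) {x : M} (hx : x ∈ φ.source) :
    chartField E φ i =ᶠ[𝓝 x] VectorField.mpullback 𝓘(ℝ, E) 𝓘(ℝ, Coord n) φ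
      (constField n i) := by
  filter_upwards [φ.open_source.mem_nhds hx] with z hz
  rw [chartField, if_pos hz]

variable [IsManifold 𝓘(ℂ, E) ω M]

theorem contMDiffAt_chartField [CompleteSpace E] (hφ : IsSmoothChart (E := E) φ) (i : Fin n) {x : M}
    (hx : x ∈ φ.source) :
    ContMDiffAt 𝓘(ℝ, E) 𝓘(ℝ, E).tangent ∞
      (fun q => (⟨q, chartField E φ i q⟩ : TangentBundle 𝓘(ℝ, E) M)) x := by
  have hf : ContMDiffAt 𝓘(ℝ, E) 𝓘(ℝ, Coord n) ∞ φ x :=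
    hφ.smooth.contMDiffAt (φ.open_source.mem_nhds hx)
  have h : ContMDiffAt 𝓘(ℝ, E) 𝓘(ℝ, E).tangent ∞
      (fun q => (⟨q, VectorField.mpullback 𝓘(ℝ, E) 𝓘(ℝ, Coord n) φ (constField n i) q⟩ :
        TangentBundle 𝓘(ℝ, E) M)) x :=
    ContMDiffAt.mpullback_vectorField_preimage (I := 𝓘(ℝ, E)) (I' := 𝓘(ℝ, Coord n))
      (m := ∞) (n := ∞) (V := constField n i)
      (contMDiff_constField n i ∞ (φ x)) hf (hφ.isInvertible_mfderiv hx)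
      le_rfl
  refine h.congr_of_eventuallyEq ?_
  filter_upwards [chartField_eventuallyEq (E := E) i hx] with z hz
  rw [hz]

theorem vfDiffAt_chartField [CompleteSpace E] (hφ : IsSmoothChart (E := E) φ) (i : Fin n) {x : M}
    (hx : x ∈ φ.source) : VFDiffAt (chartField E φ i) x :=
  (contMDiffAt_chartField hφ i hx).mdifferentiableAt (by simp)

/-- Pullback by the chart respects brackets, and constant fields commute. -/
theorem mlieBracket_chartField [CompleteSpace E] (hφ : IsSmoothChart (E := E) φ) (i j : Fin n)
    {x : M} (hx : x ∈ φ.source) :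
    VectorField.mlieBracket 𝓘(ℝ, E) (chartField E φ i) (chartField E φ j) x = 0 := by
  have hV := fun i => (contMDiff_constField n i 1).mdifferentiable one_ne_zero (φ x)
  rw [Filter.EventuallyEq.mlieBracket_vectorField_eq (chartField_eventuallyEq i hx)
    (chartField_eventuallyEq j hx), ← VectorField.mpullback_mlieBracket (n := ∞) (hV i) (hV j)
    (hφ.smooth.contMDiffAt (φ.open_source.mem_nhds hx))
    (by rw [minSmoothness_of_isRCLikeNormedField]; exact ENat.LEInfty.out),
    VectorField.mpullback_apply, mlieBracket_constField, map_zero]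

variable (g : SmoothMetric E M)

theorem contMDiffAt_inner {Y Z : Π x : M, TangentSpace 𝓘(ℝ, E) x} {x : M}
    (hY : ContMDiffAt 𝓘(ℝ, E) 𝓘(ℝ, E).tangent ∞
      (fun q => (⟨q, Y q⟩ : TangentBundle 𝓘(ℝ, E) M)) x)
    (hZ : ContMDiffAt 𝓘(ℝ, E) 𝓘(ℝ, E).tangent ∞
      (fun q => (⟨q, Z q⟩ : TangentBundle 𝓘(ℝ, E) M)) x) :
    ContMDiffAt 𝓘(ℝ, E) 𝓘(ℝ, ℝ) ∞ (fun q => g.inner q (Y q) (Z q)) x := by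
  let _ : Bundle.RiemannianBundle (fun x : M => TangentSpace 𝓘(ℝ, E) x) := ⟨g.toRiemannianMetric⟩
  exact ContMDiffAt.inner_bundle (IB := 𝓘(ℝ, E)) (F := E) (v := Y) (w := Z) hY hZ

end ChartFields

/-! ### The Levi-Civita connection in orthogonal coordinates -/

section LeviCivita

variable {E : Type*} [NormedAddCommGroup E] [NormedSpace ℂ E]
  {M : Type*} [TopologicalSpace M] [ChartedSpace E M]
  {n : ℕ} {φ : OpenPartialHomeomorph M (Coord n)}

theorem complexJ_complexJ (x : M) (v : TangentSpace 𝓘(ℝ, E) x) :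
    complexJ x (complexJ x v) = -v := by
  have h (v : E) : Complex.I • Complex.I • v = -v := by
    rw [smul_smul, Complex.I_mul_I, neg_one_smul]
  exact h v

variable [IsManifold 𝓘(ℂ, E) ω M] {g : SmoothMetric E M}

theorem IsHermitian.inner_complexJ_left (hg : IsHermitian g) (x : M)
    (v w : TangentSpace 𝓘(ℝ, E) x) :
    g.inner x (complexJ x v) w = -g.inner x v (complexJ x w) := by
  rw [← hg x v (complexJ x w), complexJ_complexJ, map_neg, neg_neg]

theorem IsOrthogonalChart.inner_chartField (h : IsOrthogonalChart g φ) {i j : Fin n} (hij : i ≠ j)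
    {x : M} (hx : x ∈ φ.source) :
    g.inner x (chartField E φ i x) (chartField E φ j x) = 0 := by
  obtain ⟨y, hy, rfl⟩ : ∃ y ∈ φ.target, φ.symm y = x := ⟨φ x, φ.map_source hx, φ.left_inv hx⟩
  rw [chartField_symm h.isSmoothChart i hy, chartField_symm h.isSmoothChart j hy]
  exact h.orthogonal y hy i j hij

variable [FiniteDimensional ℂ E]
  {D : CovariantDerivative 𝓘(ℝ, E) E (fun x : M => TangentSpace 𝓘(ℝ, E) x)}

theorem IsLeviCivita.chartField_comm (hD : IsLeviCivita g D) (hφ : IsSmoothChart (E := E) φ)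
    (i j : Fin n) {x : M} (hx : x ∈ φ.source) :
    D (chartField E φ j) x (chartField E φ i x) = D (chartField E φ i) x (chartField E φ j x) := by
  have : CompleteSpace E := FiniteDimensional.complete ℂ E
  have h := (CovariantDerivative.torsion_eq_zero_iff D).1 hD.torsion_free
    (vfDiffAt_chartField hφ i hx) (vfDiffAt_chartField hφ j hx)
  rw [mlieBracket_chartField hφ i j hx] at h
  exact sub_eq_zero.1 h

/-- Differentiate the relation `⟨∂_i, ∂_j⟩ = 0`, which holds on a whole neighborhood of `x`. -/
theorem IsLeviCivita.skew (hD : IsLeviCivita g D) (h : IsOrthogonalChart g φ)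
    {i j : Fin n} (hij : i ≠ j) {x : M} (hx : x ∈ φ.source) (v : TangentSpace 𝓘(ℝ, E) x) :
    g.inner x (D (chartField E φ i) x v) (chartField E φ j x) =
      -g.inner x (D (chartField E φ j) x v) (chartField E φ i x) := by
  have : CompleteSpace E := FiniteDimensional.complete ℂ E
  have h1 := hD.metric _ _ x (vfDiffAt_chartField h.isSmoothChart i hx)
    (vfDiffAt_chartField h.isSmoothChart j hx) v
  have h2 : mvfderiv 𝓘(ℝ, E) (fun y => g.inner y (chartField E φ i y) (chartField E φ j y)) x =
      0 := by
    have h3 : (fun y => g.inner y (chartField E φ i y) (chartField E φ j y)) =ᶠ[𝓝 x]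
        fun _ => (0 : ℝ) := by
      filter_upwards [φ.open_source.mem_nhds hx] with z hz using h.inner_chartField hij hz
    exact (h3.mfderiv_eq (I := 𝓘(ℝ, E)) (I' := 𝓘(ℝ, ℝ))).trans mfderiv_const
  rw [h2, g.symm x (chartField E φ i x)] at h1
  simp at h1
  linarith

/-- For three distinct indices the Christoffel symbol of orthogonal coordinates vanishes. -/
theorem IsLeviCivita.inner_eq_zero (hD : IsLeviCivita g D) (h : IsOrthogonalChart g φ)
    {i j l : Fin n} (hij : i ≠ j) (hjl : j ≠ l) (hil : i ≠ l) {x : M} (hx : x ∈ φ.source) :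
    g.inner x (D (chartField E φ j) x (chartField E φ i x)) (chartField E φ l x) = 0 := by
  have s := h.isSmoothChart
  -- Skewness for the three pairs of indices, together with symmetry in the two lower indices,
  -- forces the symbol to equal its own negative.
  have h1 := hD.skew h hjl hx (chartField E φ i x)
  have h2 := hD.skew h hil.symm hx (chartField E φ j x)
  have h3 := hD.skew h hij hx (chartField E φ l x)
  rw [hD.chartField_comm s i l hx] at h1
  rw [hD.chartField_comm s j l hx, hD.chartField_comm s j i hx] at h2
  linarith

/-- If `J ∂_j = σ ∂_{j'}` and `J ∂_i = τ ∂_{i'}` with `i`, `i'` distinct from `j`, `j'`, the squared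
length of `∂_i` does not vary in the direction of `∂_{j'}`. -/
theorem mvfderiv_inner_eq_zero (hg : IsHermitian g) (hD : IsLeviCivita g D)
    (hJ : ∀ (Y : Π x : M, TangentSpace 𝓘(ℝ, E) x) (x : M), VFDiffAt Y x →
        ∀ v : TangentSpace 𝓘(ℝ, E) x,
          D (fun y => complexJ y (Y y)) x v = complexJ x (D Y x v))
    (h : IsOrthogonalChart g φ) {i i' j j' : Fin n} (hii' : i ≠ i') (hij : i ≠ j) (hi'j : i' ≠ j)
    (hij' : i ≠ j') {σ : M → ℝ} {τ : ℝ} {x : M} (hx : x ∈ φ.source)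
    (hσ : MDifferentiableAt 𝓘(ℝ, E) 𝓘(ℝ, ℝ) σ x) (hσ0 : σ x ≠ 0)
    (hj : ∀ q, complexJ q (chartField E φ j q) = σ q • chartField E φ j' q)
    (hi : complexJ x (chartField E φ i x) = τ • chartField E φ i' x) :
    mvfderiv 𝓘(ℝ, E) (fun q => g.inner q (chartField E φ i q) (chartField E φ i q)) x
      (chartField E φ j' x) = 0 := by
  have : CompleteSpace E := FiniteDimensional.complete ℂ E
  have s := h.isSmoothChart
  have h1 := hD.metric _ _ x (vfDiffAt_chartField s i hx) (vfDiffAt_chartField s i hx)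
    (chartField E φ j' x)
  have h2 := hJ _ x (vfDiffAt_chartField s j hx) (chartField E φ i x)
  have h3 : (fun q => complexJ q (chartField E φ j q)) = σ • chartField E φ j' := funext hj
  rw [h3, D.isCovariantDerivativeOnUniv.leibniz (vfDiffAt_chartField s j' hx) hσ] at h2
  -- After pairing with `∂_i`, the term containing the derivative of `σ` drops out because `∂_{j'} ⊥
  -- ∂_i`. On the other side, moving `J` onto `∂_i` produces a symbol with the distinct indices `i,
  -- j, i'`.
  have h4 := congrArg (fun v => g.inner x v (chartField E φ i x)) h2
  simp only [hg.inner_complexJ_left, hi, map_smul,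
    hD.inner_eq_zero h hij hi'j.symm hii' hx, add_apply, smul_apply,
    ContinuousLinearMap.smulRight_apply, map_add, h.inner_chartField hij'.symm hx,
    neg_zero, add_zero, smul_eq_mul, mul_zero] at h4
  have h5 := (mul_eq_zero.1 h4).resolve_left hσ0
  rw [h1, g.symm x (chartField E φ i x), hD.chartField_comm s j' i hx, h5, add_zero]

end LeviCivita

/-! ### The coefficients as functions of the coordinates -/

section Coefficients

variable {E : Type*} [NormedAddCommGroup E] [NormedSpace ℂ E]
  {M : Type*} [TopologicalSpace M] [ChartedSpace E M]
  {n : ℕ} {φ : OpenPartialHomeomorph M (Coord n)}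

theorem coordField_ne_zero (hφ : IsSmoothChart (E := E) φ) (i : Fin n) {y : Coord n}
    (hy : y ∈ φ.target) : coordField E φ i y ≠ 0 := by
  intro h0
  have h1 := hφ.mdifferentiable.comp_symm_deriv hy
  have h2 := congrArg (fun L => L (EuclideanSpace.single i (1 : ℝ) : Coord n)) h1
  have h3 : mfderiv 𝓘(ℝ, E) 𝓘(ℝ, Coord n) φ (φ.symm y) (coordField E φ i y) =
    (EuclideanSpace.single i (1 : ℝ) : Coord n) := h2
  rw [h0, map_zero] at h3
  exact one_ne_zero ((PiLp.single_eq_zero_iff 2 i).1 h3.symm)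

variable [IsManifold 𝓘(ℂ, E) ω M] {g : SmoothMetric E M}

/-- The squared length of the coordinate field `∂/∂x_i`, as a function of the coordinates. -/
def sqCoeff (g : SmoothMetric E M) (φ : OpenPartialHomeomorph M (Coord n)) (i : Fin n)
    (y : Coord n) : ℝ :=
  g.inner (φ.symm y) (coordField E φ i y) (coordField E φ i y)

theorem sqCoeff_pos (hφ : IsSmoothChart (E := E) φ) (i : Fin n) {y : Coord n}
    (hy : y ∈ φ.target) : 0 < sqCoeff g φ i y :=
  g.pos _ _ (coordField_ne_zero hφ i hy)

theorem coeff_pos (hφ : IsSmoothChart (E := E) φ) (i : Fin n) {y : Coord n}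
    (hy : y ∈ φ.target) : 0 < coeff g φ i y :=
  Real.sqrt_pos.2 (sqCoeff_pos hφ i hy)

theorem coeff_sq (hφ : IsSmoothChart (E := E) φ) (i : Fin n) {y : Coord n}
    (hy : y ∈ φ.target) : coeff g φ i y ^ 2 = sqCoeff g φ i y :=
  Real.sq_sqrt (sqCoeff_pos hφ i hy).le

theorem sqCoeff_eq (hφ : IsSmoothChart (E := E) φ) (i : Fin n) {y : Coord n}
    (hy : y ∈ φ.target) : sqCoeff g φ i y =
      ((fun q => g.inner q (chartField E φ i q) (chartField E φ i q)) ∘ φ.symm) y := by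
  rw [Function.comp_apply, chartField_symm hφ i hy]
  rfl

variable [CompleteSpace E]

theorem contDiffOn_sqCoeff (hφ : IsSmoothChart (E := E) φ) (i : Fin n) :
    ContDiffOn ℝ ∞ (sqCoeff g φ i) φ.target := by
  rw [← contMDiffOn_iff_contDiffOn]
  intro y hy
  have h1 := contMDiffAt_inner g (contMDiffAt_chartField hφ i (φ.map_target hy))
    (contMDiffAt_chartField hφ i (φ.map_target hy))
  exact (h1.comp_contMDiffWithinAt y (hφ.smooth_symm y hy)).congr
    (fun z hz => sqCoeff_eq hφ i hz) (sqCoeff_eq hφ i hy)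

/-- Chain rule: it moves the connection identities, which live on `M`, to partial derivatives in
coordinates. -/
theorem fderiv_sqCoeff_single (hφ : IsSmoothChart (E := E) φ) (i j : Fin n) {y : Coord n}
    (hy : y ∈ φ.target) :
    fderiv ℝ (sqCoeff g φ i) y (EuclideanSpace.single j 1) =
      mvfderiv 𝓘(ℝ, E) (fun q => g.inner q (chartField E φ i q) (chartField E φ i q)) (φ.symm y)
        (chartField E φ j (φ.symm y)) := by
  have h1 : MDifferentiableAt 𝓘(ℝ, E) 𝓘(ℝ, ℝ)
      (fun q => g.inner q (chartField E φ i q) (chartField E φ i q)) (φ.symm y) :=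
    (contMDiffAt_inner g (contMDiffAt_chartField hφ i (φ.map_target hy))
    (contMDiffAt_chartField hφ i (φ.map_target hy))).mdifferentiableAt (by simp)
  have h2 : sqCoeff g φ i =ᶠ[𝓝 y]
      (fun q => g.inner q (chartField E φ i q) (chartField E φ i q)) ∘ φ.symm := by
    filter_upwards [φ.open_target.mem_nhds hy] with z hz using sqCoeff_eq hφ i hz
  rw [h2.fderiv_eq, ← mfderiv_eq_fderiv,
    mfderiv_comp y h1 (hφ.mdifferentiable.mdifferentiableAt_symm hy), chartField_symm hφ j hy]
  rfl

end Coefficients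

/-! ### Pairs of indices and vanishing of the mixed derivatives -/

theorem eq_fstIdx_or_sndIdx {m : ℕ} (i : Fin (2 * m)) :
    ∃ k : Fin m, i = fstIdx k ∨ i = sndIdx k := by
  refine ⟨⟨i / 2, by omega⟩, ?_⟩
  rcases Nat.mod_two_eq_zero_or_one i with h | h
  · left
    ext
    simp only [fstIdx]
    omega
  · right
    ext
    simp only [sndIdx]
    omega

theorem fstIdx_ne_sndIdx {m : ℕ} (k l : Fin m) : fstIdx k ≠ sndIdx l := by
  intro h
  have := congrArg Fin.val h
  simp only [fstIdx, sndIdx] at this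
  omega

theorem fstIdx_injective {m : ℕ} : Function.Injective (fstIdx : Fin m → Fin (2 * m)) := by
  intro k l h
  have := congrArg Fin.val h
  simp only [fstIdx] at this
  omega

theorem sndIdx_injective {m : ℕ} : Function.Injective (sndIdx : Fin m → Fin (2 * m)) := by
  intro k l h
  have := congrArg Fin.val h
  simp only [sndIdx] at this
  omega

section Unitary

variable {E : Type*} [NormedAddCommGroup E] [NormedSpace ℂ E]
  {M : Type*} [TopologicalSpace M] [ChartedSpace E M] [IsManifold 𝓘(ℂ, E) ω M]
  {m : ℕ} {φ : OpenPartialHomeomorph M (Coord (2 * m))} {g : SmoothMetric E M}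

theorem IsUnitaryOrthogonalChart.complexJ_coordField_fst (h : IsUnitaryOrthogonalChart g φ)
    (k : Fin m) {y : Coord (2 * m)} (hy : y ∈ φ.target) :
    complexJ (φ.symm y) (coordField E φ (fstIdx k) y) =
      (coeff g φ (fstIdx k) y / coeff g φ (sndIdx k) y) • coordField E φ (sndIdx k) y := by
  have h1 := h.map_fst y hy k
  have h2 : coeff g φ (fstIdx k) y ≠ 0 := (coeff_pos h.1.1 _ hy).ne'
  rw [frame, frame, map_smul, inv_smul_eq_iff₀ h2, smul_smul] at h1
  rw [h1, div_eq_mul_inv]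

theorem IsUnitaryOrthogonalChart.complexJ_coordField_snd (h : IsUnitaryOrthogonalChart g φ)
    (k : Fin m) {y : Coord (2 * m)} (hy : y ∈ φ.target) :
    complexJ (φ.symm y) (coordField E φ (sndIdx k) y) =
      (-(coeff g φ (sndIdx k) y / coeff g φ (fstIdx k) y)) • coordField E φ (fstIdx k) y := by
  have h1 := h.map_snd y hy k
  have h2 : coeff g φ (sndIdx k) y ≠ 0 := (coeff_pos h.1.1 _ hy).ne'
  rw [frame, frame, map_smul, inv_smul_eq_iff₀ h2, smul_neg, smul_smul] at h1
  rw [h1, div_eq_mul_inv, neg_smul]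

/-- The sign `ε` puts the two unitarity relations in one form, so that later arguments need not
distinguish the first and second index of a pair. -/
theorem IsUnitaryOrthogonalChart.exists_partner (h : IsUnitaryOrthogonalChart g φ) (k : Fin m)
    {j : Fin (2 * m)} (hj : j = fstIdx k ∨ j = sndIdx k) :
    ∃ j', (j' = fstIdx k ∨ j' = sndIdx k) ∧ j ≠ j' ∧ ∃ ε : ℝ, ε ≠ 0 ∧ ∀ y ∈ φ.target,
      complexJ (φ.symm y) (coordField E φ j y) =
        (ε * (coeff g φ j y / coeff g φ j' y)) • coordField E φ j' y := by
  rcases hj with rfl | rfl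
  · refine ⟨sndIdx k, Or.inr rfl, fstIdx_ne_sndIdx k k, 1, one_ne_zero, fun y hy => ?_⟩
    rw [one_mul, h.complexJ_coordField_fst k hy]
  · refine ⟨fstIdx k, Or.inl rfl, (fstIdx_ne_sndIdx k k).symm, -1, by simp, fun y hy => ?_⟩
    rw [h.complexJ_coordField_snd k hy, neg_one_mul]

variable [FiniteDimensional ℂ E]

theorem IsUnitaryOrthogonalChart.fderiv_sqCoeff (h : IsUnitaryOrthogonalChart g φ)
    (hg : IsKahler g) {k l : Fin m} (hkl : k ≠ l) {i j : Fin (2 * m)}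
    (hi : i = fstIdx k ∨ i = sndIdx k) (hj : j = fstIdx l ∨ j = sndIdx l)
    {y : Coord (2 * m)} (hy : y ∈ φ.target) :
    fderiv ℝ (sqCoeff g φ i) y (EuclideanSpace.single j 1) = 0 := by
  have : CompleteSpace E := FiniteDimensional.complete ℂ E
  obtain ⟨D, hD, hJ⟩ := hg.parallel
  have s := h.1.1
  have hne : ∀ {i j : Fin (2 * m)}, (i = fstIdx k ∨ i = sndIdx k) →
      (j = fstIdx l ∨ j = sndIdx l) → i ≠ j := by
    rintro i j (rfl | rfl) (rfl | rfl)
    · exact fun e => hkl (fstIdx_injective e)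
    · exact fstIdx_ne_sndIdx k l
    · exact (fstIdx_ne_sndIdx l k).symm
    · exact fun e => hkl (sndIdx_injective e)
  obtain ⟨i', hi', hii', ε, -, hiJ⟩ := h.exists_partner k hi
  obtain ⟨j', hj', hjj', -⟩ := h.exists_partner l hj
  -- To differentiate along `∂_j`, this field must appear as a multiple of `J ∂_{j'}`. So the
  -- partner is taken twice, which returns to `j`.
  obtain ⟨j'', hj'', hjj'', δ, hδ, hjJ⟩ := h.exists_partner l hj'
  have e : j = j'' := by
    rcases hj with rfl | rfl <;> rcases hj' with rfl | rfl <;> rcases hj'' with rfl | rfl <;>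
      first | rfl | exact absurd rfl hjj' | exact absurd rfl hjj''
  subst e
  rw [fderiv_sqCoeff_single s i j hy]
  have hd : ∀ i : Fin (2 * m), DifferentiableAt ℝ (coeff g φ i) y := fun i =>
    (((contDiffOn_sqCoeff s i).contDiffAt (φ.open_target.mem_nhds hy)).differentiableAt
      (by simp)).sqrt (sqCoeff_pos s i hy).ne'
  have hσ : DifferentiableAt ℝ (fun y => δ * (coeff g φ j' y / coeff g φ j y)) y := by
    simp only [div_eq_mul_inv]
    exact ((hd j').fun_mul ((hd j).fun_inv (coeff_pos s j hy).ne')).const_mul δ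
  rw [← φ.right_inv hy] at hσ
  refine mvfderiv_inner_eq_zero hg.1 hD hJ h.1 (i := i) (i' := i') (j := j') (j' := j)
    (σ := fun q => δ * (coeff g φ j' (φ q) / coeff g φ j (φ q)))
    hii' (hne hi hj') (hne hi' hj') (hne hi hj) (φ.map_target hy) ?_ ?_ ?_
    (τ := ε * (coeff g φ i y / coeff g φ i' y)) ?_
  · exact hσ.mdifferentiableAt.comp (φ.symm y)
      (s.mdifferentiable.mdifferentiableAt (φ.map_target hy))
  · have := coeff_pos (g := g) s j' hy
    have := coeff_pos (g := g) s j hy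
    simp only [φ.right_inv hy]
    positivity
  · intro q
    by_cases hq : q ∈ φ.source
    · have := hjJ _ (φ.map_source hq)
      rw [← chartField_symm s j' (φ.map_source hq), ← chartField_symm s j (φ.map_source hq)] at this
      rwa [φ.left_inv hq] at this
    -- Off the chart domain both fields are zero by definition, so the relation holds on all of `M`,
    -- as an equality of global fields.
    · simp [chartField, hq]
  · rw [chartField_symm s i hy, chartField_symm s i' hy]
    exact hiJ y hy

/-- The vector `z - y` has no component in the `k`-th pair, so `f` has zero derivative along the
segment from `y` to `z`, which convexity keeps inside the domain. -/
theorem dependsOnlyOnPair_of_fderiv {k : Fin m} {f : Coord (2 * m) → ℝ}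
    (hf : DifferentiableOn ℝ f φ.target)
    (hf' : ∀ y ∈ φ.target, ∀ j, j ≠ fstIdx k → j ≠ sndIdx k →
      fderiv ℝ f y (EuclideanSpace.single j 1) = 0) : DependsOnlyOnPair φ k f := by
  intro V hV hVT y hy z hz h1 h2
  have key : ∀ x ∈ φ.target, fderiv ℝ f x (z - y) = 0 := by
    intro x hx
    have e : z - y = ∑ j, (z - y) j • (EuclideanSpace.single j (1 : ℝ) : Coord (2 * m)) := by
      simpa using ((EuclideanSpace.basisFun (Fin (2 * m)) ℝ).sum_repr (z - y)).symm
    rw [e, map_sum]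
    refine Finset.sum_eq_zero fun j _ => ?_
    rw [map_smul]
    by_cases hj : j = fstIdx k
    · subst hj
      simp [h1]
    by_cases hj' : j = sndIdx k
    · subst hj'
      simp [h2]
    rw [hf' x hx j hj hj', smul_zero]
  have hmem : ∀ t ∈ Set.Icc (0 : ℝ) 1, y + t • (z - y) ∈ φ.target := fun t ht =>
    hVT (hV.add_smul_sub_mem hy hz ht)
  have hd : ∀ t ∈ Set.Icc (0 : ℝ) 1, HasDerivAt (fun t : ℝ => f (y + t • (z - y))) 0 t := by
    intro t ht
    have d1 := (hf.differentiableAt (φ.open_target.mem_nhds (hmem t ht))).hasFDerivAt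
    have d2 : HasDerivAt (fun t : ℝ => y + t • (z - y)) (z - y) t := by
      simpa using ((hasDerivAt_id t).smul_const (z - y)).const_add y
    have d3 := d1.comp_hasDerivAt t d2
    rwa [key _ (hmem t ht)] at d3
  have := constant_of_has_deriv_right_zero
    (fun t ht => (hd t ht).continuousAt.continuousWithinAt)
    (fun t ht => (hd t (Set.Ico_subset_Icc_self ht)).hasDerivWithinAt) 1 (by simp)
  simpa using this.symm

theorem IsUnitaryOrthogonalChart.dependsOnlyOnPair_sqCoeff (h : IsUnitaryOrthogonalChart g φ)
    (hg : IsKahler g) {k : Fin m} {i : Fin (2 * m)} (hi : i = fstIdx k ∨ i = sndIdx k) :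
    DependsOnlyOnPair φ k (sqCoeff g φ i) := by
  have : CompleteSpace E := FiniteDimensional.complete ℂ E
  refine dependsOnlyOnPair_of_fderiv
    ((contDiffOn_sqCoeff h.1.1 i).differentiableOn (by simp)) fun y hy j hj hj' => ?_
  obtain ⟨l, hl⟩ := eq_fstIdx_or_sndIdx j
  refine h.fderiv_sqCoeff hg (l := l) ?_ hi hl hy
  rintro rfl
  exact hl.elim hj hj'

theorem IsUnitaryOrthogonalChart.dependsOnlyOnPair_coeff (h : IsUnitaryOrthogonalChart g φ)
    (hg : IsKahler g) {k : Fin m} {i : Fin (2 * m)} (hi : i = fstIdx k ∨ i = sndIdx k) :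
    DependsOnlyOnPair φ k (coeff g φ i) := fun V hV hVT y hy z hz h1 h2 =>
  congrArg Real.sqrt (h.dependsOnlyOnPair_sqCoeff hg hi V hV hVT y hy z hz h1 h2)

end Unitary
-- Conformal maps between plane domains
theorem apply_eq_of_conformal {L : ℂ →L[ℝ] ℂ} {ρ : ℝ} (hρ : ρ ≠ 0)
    (hL : Complex.I * L 1 = ρ * L Complex.I) (v : ℂ) :
    L v = L 1 * ⟨v.re, v.im / ρ⟩ := by
  -- The hypothesis is a linear Beltrami equation: once the imaginary axis is rescaled by `1 / ρ`,
  -- the map `L` is multiplication by `L 1`.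
  have h1 : v = v.re • (1 : ℂ) + v.im • Complex.I := by
    apply Complex.ext <;> simp
  have h2 : L Complex.I = Complex.I * L 1 / ρ := by
    rw [hL, mul_div_cancel_left₀ _ (Complex.ofReal_ne_zero.2 hρ)]
  have h3 : (⟨v.re, v.im / ρ⟩ : ℂ) = v.re + v.im / ρ * Complex.I := by
    rw [Complex.mk_eq_add_mul_I, Complex.ofReal_div]
  conv_lhs => rw [h1]
  rw [map_add, map_smul, map_smul, h2, h3, Complex.real_smul, Complex.real_smul]
  ring

theorem injective_of_conformal {L : ℂ →L[ℝ] ℂ} {ρ : ℝ} (hρ : ρ ≠ 0)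
    (hL : Complex.I * L 1 = ρ * L Complex.I) (h1 : L 1 ≠ 0) : Function.Injective L := by
  rw [injective_iff_map_eq_zero]
  intro v hv
  rw [apply_eq_of_conformal hρ hL, mul_eq_zero, or_iff_right h1, Complex.ext_iff] at hv
  apply Complex.ext
  · exact hv.1
  · simpa [hρ] using hv.2

/-- An injective real-linear endomorphism of `ℂ`, as an equivalence. -/
def equivOfInjective (L : ℂ →L[ℝ] ℂ) (hL : Function.Injective L) : ℂ ≃L[ℝ] ℂ :=
  (LinearEquiv.ofInjectiveEndo (L : ℂ →ₗ[ℝ] ℂ) hL).toContinuousLinearEquiv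

theorem coe_equivOfInjective (L : ℂ →L[ℝ] ℂ) (hL : Function.Injective L) :
    (equivOfInjective L hL : ℂ →L[ℝ] ℂ) = L := by
  ext
  rfl

theorem innerForm_mul (a v w : ℂ) :
    Disc.innerForm (a * v) (a * w) = ‖a‖ ^ 2 * (v.re * w.re + v.im * w.im) := by
  rw [Disc.innerForm_apply, Complex.sq_norm, Complex.normSq_apply]
  simp only [Complex.mul_re, Complex.mul_im]
  ring

/-- A smooth map `W` between plane domains that is conformal for the metric
`A (dx² + dy² / ρ²)` on its domain restricts to an isometry from a neighborhood of any
nondegenerate point onto a Riemann surface. -/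
theorem exists_conformal_chart {W : ℂ → ℂ} {O : Set ℂ} (hO : IsOpen O) {u₀ : ℂ} (hu₀ : u₀ ∈ O)
    (hW : ContDiffOn ℝ ∞ W O) {ρ A : ℂ → ℝ} (hρ : ∀ u ∈ O, ρ u ≠ 0)
    (hA : ContDiffOn ℝ ∞ A O) (hApos : ∀ u ∈ O, 0 < A u)
    (hJ : ∀ u ∈ O, Complex.I * fderiv ℝ W u 1 = ρ u * fderiv ℝ W u Complex.I)
    (h0 : fderiv ℝ W u₀ 1 ≠ 0) :
    ∃ (S : MetricRiemannSurface) (e : OpenPartialHomeomorph ℂ S.carrier),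
      u₀ ∈ e.source ∧ e.source ⊆ O ∧ e.target = Set.univ ∧
      (∀ u ∈ e.source, HasMFDerivAt 𝓘(ℝ, ℂ) 𝓘(ℝ, ℂ) e u (fderiv ℝ W u)) ∧
      ∀ u ∈ e.source, ∀ v w : ℂ,
        S.metric.inner (e u) (fderiv ℝ W u v : ℂ) (fderiv ℝ W u w : ℂ) =
          A u * (v.re * w.re + v.im / ρ u * (w.im / ρ u)) := by
  have hd : ContDiffOn ℝ ∞ (fun u => fderiv ℝ W u 1) O :=
    (hW.fderiv_of_isOpen hO (m := ∞) (by simp)).clm_apply contDiffOn_const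
  let O' := O ∩ (fun u => fderiv ℝ W u 1) ⁻¹' {0}ᶜ
  have hO' : IsOpen O' := hd.continuousOn.isOpen_inter_preimage hO isOpen_compl_singleton
  have hWu : ∀ u ∈ O, ContDiffAt ℝ ∞ W u := fun u hu => hW.contDiffAt (hO.mem_nhds hu)
  have hinj : ∀ u ∈ O', Function.Injective (fderiv ℝ W u) := fun u hu =>
    injective_of_conformal (hρ u hu.1) (hJ u hu.1) hu.2
  have hequiv : ∀ u (hu : u ∈ O'), HasFDerivAt W
      (equivOfInjective (fderiv ℝ W u) (hinj u hu) : ℂ →L[ℝ] ℂ) u := fun u hu => by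
    rw [coe_equivOfInjective]
    exact ((hWu u hu.1).differentiableAt (by simp)).hasFDerivAt
  have hu₀' : u₀ ∈ O' := ⟨hu₀, h0⟩
  let e₀ := (hWu u₀ hu₀).toOpenPartialHomeomorph W (hequiv u₀ hu₀') (by simp)
  let e₁ := e₀.restrOpen O' hO'
  have hmem : u₀ ∈ e₁.source :=
    ⟨(hWu u₀ hu₀).mem_toOpenPartialHomeomorph_source (hequiv u₀ hu₀') (by simp), hu₀'⟩
  -- Shrinking the image to a disc makes it connected, hence a Riemann surface that the chart covers
  -- entirely.
  obtain ⟨r, hr, hball⟩ := Metric.isOpen_iff.1 e₁.open_target (W u₀) (e₁.map_source hmem)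
  have : Fact (0 < r) := ⟨hr⟩
  have hsO : ∀ w ∈ Metric.ball (W u₀) r, e₁.symm w ∈ O' := fun w hw =>
    (e₁.map_target (hball hw)).2
  have hsymm : ContDiffOn ℝ ∞ e₁.symm (Metric.ball (W u₀) r) := fun w hw =>
    (e₁.contDiffAt_symm (hball hw) (hequiv _ (hsO w hw))
      (hWu _ (hsO w hw).1)).contDiffWithinAt
  have hmaps : Set.MapsTo e₁.symm (Metric.ball (W u₀) r) O := fun w hw => (hsO w hw).1
  -- The differential of `W` multiplies `dx² + dy² / ρ²` by `|W_x|²`, so this is the conformal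
  -- factor whose pullback is `A (dx² + dy² / ρ²)`.
  have ha : ContDiffOn ℝ ∞ (fun w => A (e₁.symm w) / ‖fderiv ℝ W (e₁.symm w) 1‖ ^ 2)
      (Metric.ball (W u₀) r) :=
    (hA.comp hsymm hmaps).div ((hd.comp hsymm hmaps).norm_sq ℝ)
      fun w hw => pow_ne_zero 2 (norm_ne_zero_iff.2 (hsO w hw).2)
  have hpos : ∀ w ∈ Metric.ball (W u₀) r,
      0 < A (e₁.symm w) / ‖fderiv ℝ W (e₁.symm w) 1‖ ^ 2 := fun w hw =>
    div_pos (hApos _ (hsO w hw).1) (pow_pos (norm_pos_iff.2 (hsO w hw).2) 2)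
  let val := Disc.isOpenEmbedding_val.toOpenPartialHomeomorph (Disc.val : Disc (W u₀) r → ℂ)
  let e : OpenPartialHomeomorph ℂ (Disc (W u₀) r) := e₁.trans val.symm
  have hes : ∀ u ∈ e.source, u ∈ e₁.source ∧ W u ∈ Metric.ball (W u₀) r := by
    intro u hu
    refine ⟨hu.1, ?_⟩
    have : W u ∈ val.target := hu.2
    rwa [Disc.isOpenEmbedding_val.toOpenPartialHomeomorph_target, Disc.range_val] at this
  have hval : ∀ u ∈ e.source, (e u).val = W u := fun u hu => val.right_inv hu.2
  refine ⟨Disc.conformalSurface (W u₀) r _ ha hpos, e, ⟨hmem, ?_⟩,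
    fun u hu => (hes u hu).1.2.1, ?_, ?_, ?_⟩
  · change W u₀ ∈ val.target
    rw [Disc.isOpenEmbedding_val.toOpenPartialHomeomorph_target, Disc.range_val]
    exact Metric.mem_ball_self hr
  · rw [Set.eq_univ_iff_forall]
    exact fun x => ⟨trivial, hball x.mem⟩
  · intro u hu
    have h1 : HasMFDerivAt 𝓘(ℝ, ℂ) 𝓘(ℝ, ℂ) (fun u => (e u).val) u (fderiv ℝ W u) := by
      have h2 : HasFDerivAt (fun u => (e u).val) (fderiv ℝ W u) u := by
        refine (((hWu u (hes u hu).1.2.1).differentiableAt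
          (by simp)).hasFDerivAt).congr_of_eventuallyEq ?_
        filter_upwards [e.open_source.mem_nhds hu] with z hz using hval z hz
      exact h2.hasMFDerivAt
    exact Disc.hasMFDerivAt_of_val_comp h1
  · intro u hu v w
    have hu' := (hes u hu).1.2
    have h1 : e₁.symm (e u).val = u := by
      rw [hval u hu]
      exact e₁.left_inv (hes u hu).1
    have h2 : ∀ V V' : ℂ, (Disc.conformalSurface (W u₀) r _ ha hpos).metric.inner (e u) V V' =
        A (e₁.symm (e u).val) / ‖fderiv ℝ W (e₁.symm (e u).val) 1‖ ^ 2 * Disc.innerForm V V' :=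
      fun V V' => rfl
    refine (h2 _ _).trans ?_
    rw [h1, apply_eq_of_conformal (hρ u hu'.1) (hJ u hu'.1) v,
      apply_eq_of_conformal (hρ u hu'.1) (hJ u hu'.1) w, innerForm_mul]
    have h3 : ‖fderiv ℝ W u 1‖ ≠ 0 := norm_ne_zero_iff.2 hu'.2
    field_simp

/-! ### Grouping real coordinates into complex ones; slices -/

section Pairs

variable {m : ℕ}

/-- The identification of `ℝ²ᵐ` with `ℂᵐ` that groups the coordinates in pairs. -/
def pairEquiv (m : ℕ) : Coord (2 * m) ≃L[ℝ] (Fin m → ℂ) :=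
  LinearEquiv.toContinuousLinearEquiv
    { toFun := fun y k => ⟨y (fstIdx k), y (sndIdx k)⟩
      map_add' := fun y z => by funext k; apply Complex.ext <;> simp
      map_smul' := fun a y => by funext k; apply Complex.ext <;> simp
      invFun := fun u => WithLp.toLp 2 fun i =>
        if (i : ℕ) % 2 = 0 then (u ⟨i / 2, by omega⟩).re else (u ⟨i / 2, by omega⟩).im
      left_inv := fun y => by
        ext i
        obtain ⟨k, rfl | rfl⟩ := eq_fstIdx_or_sndIdx i
        · simp [fstIdx]
        · have h : (2 * (k : ℕ) + 1) / 2 = k := by omega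
          simp [sndIdx, Nat.add_mod, h]
      right_inv := fun u => by
        funext k
        apply Complex.ext
        · simp [fstIdx]
        · have h : (2 * (k : ℕ) + 1) / 2 = k := by omega
          simp [sndIdx, Nat.add_mod, h] }

theorem pairEquiv_apply (y : Coord (2 * m)) (k : Fin m) :
    pairEquiv m y k = ⟨y (fstIdx k), y (sndIdx k)⟩ := rfl

theorem pairEquiv_symm_fst (u : Fin m → ℂ) (k : Fin m) :
    (pairEquiv m).symm u (fstIdx k) = (u k).re := by
  conv_rhs => rw [← (pairEquiv m).apply_symm_apply u, pairEquiv_apply]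

theorem pairEquiv_symm_snd (u : Fin m → ℂ) (k : Fin m) :
    (pairEquiv m).symm u (sndIdx k) = (u k).im := by
  conv_rhs => rw [← (pairEquiv m).apply_symm_apply u, pairEquiv_apply]

theorem pairEquiv_single_fst (k : Fin m) :
    pairEquiv m (EuclideanSpace.single (fstIdx k) 1) = Pi.single k 1 := by
  funext l
  apply Complex.ext
  · by_cases h : l = k
    · subst h
      simp [pairEquiv_apply]
    · simp [pairEquiv_apply, h, fstIdx_injective.eq_iff]
  · by_cases h : l = k
    · subst h
      simp [pairEquiv_apply, (fstIdx_ne_sndIdx _ _).symm]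
    · simp [pairEquiv_apply, h, (fstIdx_ne_sndIdx _ _).symm]

theorem pairEquiv_single_snd (k : Fin m) :
    pairEquiv m (EuclideanSpace.single (sndIdx k) 1) = Pi.single k Complex.I := by
  funext l
  apply Complex.ext
  · by_cases h : l = k
    · subst h
      simp [pairEquiv_apply, fstIdx_ne_sndIdx]
    · simp [pairEquiv_apply, h, fstIdx_ne_sndIdx]
  · by_cases h : l = k
    · subst h
      simp [pairEquiv_apply]
    · simp [pairEquiv_apply, h, sndIdx_injective.eq_iff]

theorem sum_eq_sum_pairs (f : Fin (2 * m) → ℝ) :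
    ∑ i, f i = ∑ k : Fin m, (f (fstIdx k) + f (sndIdx k)) := by
  have h : (Finset.univ : Finset (Fin (2 * m))) =
      Finset.univ.image fstIdx ∪ Finset.univ.image sndIdx := by
    ext i
    obtain ⟨k, h | h⟩ := eq_fstIdx_or_sndIdx i <;> simp [h]
  rw [h, Finset.sum_union, Finset.sum_image fstIdx_injective.injOn,
    Finset.sum_image sndIdx_injective.injOn, Finset.sum_add_distrib]
  rw [Finset.disjoint_left]
  simp only [Finset.mem_image, Finset.mem_univ, true_and, not_exists, forall_exists_index]
  rintro _ k rfl l h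
  exact fstIdx_ne_sndIdx k l h.symm

/-- The point with `k`-th complex coordinate `u` and the other ones as those of `y₀`. -/
def slice (y₀ : Coord (2 * m)) (k : Fin m) (u : ℂ) : Coord (2 * m) :=
  (pairEquiv m).symm (Function.update (pairEquiv m y₀) k u)

theorem slice_self (y₀ : Coord (2 * m)) (k : Fin m) : slice y₀ k (pairEquiv m y₀ k) = y₀ := by
  simp [slice]

theorem slice_fst (y₀ y : Coord (2 * m)) (k : Fin m) :
    slice y₀ k (pairEquiv m y k) (fstIdx k) = y (fstIdx k) := by
  simp [slice, pairEquiv_symm_fst, pairEquiv_apply]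

theorem slice_snd (y₀ y : Coord (2 * m)) (k : Fin m) :
    slice y₀ k (pairEquiv m y k) (sndIdx k) = y (sndIdx k) := by
  simp [slice, pairEquiv_symm_snd, pairEquiv_apply]

theorem hasFDerivAt_slice (y₀ : Coord (2 * m)) (k : Fin m) (u : ℂ) :
    HasFDerivAt (slice y₀ k) ((pairEquiv m).symm.toContinuousLinearMap ∘L
      ContinuousLinearMap.single ℝ (fun _ : Fin m => ℂ) k) u := by
  have e : ContinuousLinearMap.single ℝ (fun _ : Fin m => ℂ) k =
      ContinuousLinearMap.pi (Pi.single k (ContinuousLinearMap.id ℝ ℂ)) := by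
    refine ContinuousLinearMap.ext fun v => funext fun l => ?_
    by_cases h : l = k
    · subst h
      simp
    · simp [h]
  rw [e]
  exact (pairEquiv m).symm.toContinuousLinearMap.hasFDerivAt.comp u
    (hasFDerivAt_update (𝕜 := ℝ) (pairEquiv m y₀) (i := k) u)

theorem contDiff_slice (y₀ : Coord (2 * m)) (k : Fin m) : ContDiff ℝ ∞ (slice y₀ k) :=
  (pairEquiv m).symm.contDiff.comp (contDiff_update ∞ (pairEquiv m y₀) k)

theorem slice_mem_ball {y₀ : Coord (2 * m)} {k : Fin m} {u : ℂ} {ε : ℝ}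
    (hu : u ∈ Metric.ball (pairEquiv m y₀ k) ε) :
    pairEquiv m (slice y₀ k u) ∈ Metric.ball (pairEquiv m y₀) ε := by
  have hε : 0 < ε := Metric.pos_of_mem_ball hu
  rw [slice, ContinuousLinearEquiv.apply_symm_apply, Metric.mem_ball, dist_pi_lt_iff hε]
  intro l
  by_cases h : l = k
  · subst h
    simpa using hu
  · simpa [h] using hε

end Pairs

/-! ### The metric in the coordinate frame -/

section Frame

variable {E : Type*} [NormedAddCommGroup E] [NormedSpace ℂ E]
  {M : Type*} [TopologicalSpace M] [ChartedSpace E M] [IsManifold 𝓘(ℂ, E) ω M]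
  {n : ℕ} {φ : OpenPartialHomeomorph M (Coord n)} {g : SmoothMetric E M}

theorem IsOrthogonalChart.inner_mfderiv_symm (h : IsOrthogonalChart g φ) {y : Coord n}
    (hy : y ∈ φ.target) (ξ η : Coord n) :
    g.inner (φ.symm y) (mfderiv 𝓘(ℝ, Coord n) 𝓘(ℝ, E) φ.symm y ξ)
      (mfderiv 𝓘(ℝ, Coord n) 𝓘(ℝ, E) φ.symm y η) = ∑ i, sqCoeff g φ i y * (ξ i * η i) := by
  have e : ∀ ξ : Coord n, mfderiv 𝓘(ℝ, Coord n) 𝓘(ℝ, E) φ.symm y ξ =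
      ∑ i, ξ i • coordField E φ i y := by
    intro ξ
    have e : ξ = ∑ j, ξ j • (EuclideanSpace.single j (1 : ℝ) : Coord n) := by
      simpa using ((EuclideanSpace.basisFun (Fin n) ℝ).sum_repr ξ).symm
    conv_lhs => rw [e]
    exact (map_sum _ _ _).trans (Finset.sum_congr rfl fun i _ => map_smul _ _ _)
  rw [e ξ, e η, map_sum, map_sum]
  refine Finset.sum_congr rfl fun i _ => ?_
  rw [sum_apply, Finset.sum_eq_single i]
  · rw [map_smul, map_smul, smul_apply, sqCoeff, smul_eq_mul, smul_eq_mul]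
    ring
  · intro j _ hj
    rw [map_smul, map_smul, smul_apply, h.orthogonal y hy j i hj, smul_zero, smul_zero]
  · simp

end Frame

/-! ### The Riemann surface carrying each pair -/

/-- The part of the coordinate domain of `φ` covered by the holomorphic chart around `p`. -/
def holoDomain (E : Type*) [NormedAddCommGroup E] {M : Type*} [TopologicalSpace M]
    [ChartedSpace E M] {m : ℕ} (φ : OpenPartialHomeomorph M (Coord (2 * m))) (p : M) :
    Set (Coord (2 * m)) :=
  φ.target ∩ φ.symm ⁻¹' (chartAt E p).source

theorem isOpen_holoDomain {E : Type*} [NormedAddCommGroup E] {M : Type*} [TopologicalSpace M]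
    [ChartedSpace E M] {m : ℕ} {φ : OpenPartialHomeomorph M (Coord (2 * m))} (p : M) :
    IsOpen (holoDomain E φ p) :=
  φ.symm.isOpen_inter_preimage (chartAt E p).open_source

section LocalProduct

variable {E : Type*} [NormedAddCommGroup E] [NormedSpace ℂ E]
  {M : Type*} [TopologicalSpace M] [ChartedSpace E M] [IsManifold 𝓘(ℂ, E) ω M]
  {m : ℕ} {φ : OpenPartialHomeomorph M (Coord (2 * m))} {g : SmoothMetric E M}

/-- The holomorphic chart of `M` around `p`, read in the coordinates of `φ`. -/
def holoCoord (φ : OpenPartialHomeomorph M (Coord (2 * m))) (p : M) (y : Coord (2 * m)) : E :=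
  chartAt E p (φ.symm y)

theorem contDiffOn_holoCoord (hφ : IsSmoothChart (E := E) φ) (p : M) :
    ContDiffOn ℝ ∞ (holoCoord φ p : Coord (2 * m) → E) (holoDomain E φ p) := by
  rw [← contMDiffOn_iff_contDiffOn]
  exact (contMDiffOn_chart (I := 𝓘(ℝ, E)) (x := p)).comp
    (hφ.smooth_symm.mono Set.inter_subset_left) fun y hy => hy.2

theorem fderiv_holoCoord (hφ : IsSmoothChart (E := E) φ) (p : M) {y : Coord (2 * m)}
    (hy : y ∈ holoDomain E φ p) (i : Fin (2 * m)) :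
    (fderiv ℝ (holoCoord φ p : Coord (2 * m) → E) y (EuclideanSpace.single i 1) : E) =
      mfderiv 𝓘(ℝ, E) 𝓘(ℝ, E) (chartAt E p) (φ.symm y) (coordField E φ i y) := by
  have h : (holoCoord φ p : Coord (2 * m) → E) = chartAt E p ∘ φ.symm := rfl
  rw [← mfderiv_eq_fderiv, h, mfderiv_comp y
    ((mdifferentiable_chart (I := 𝓘(ℝ, E)) p).mdifferentiableAt hy.2)
    (hφ.mdifferentiable.mdifferentiableAt_symm hy.1)]
  rfl

theorem fderiv_holoCoord_ne_zero (hφ : IsSmoothChart (E := E) φ) (p : M) {y : Coord (2 * m)}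
    (hy : y ∈ holoDomain E φ p) (i : Fin (2 * m)) :
    (fderiv ℝ (holoCoord φ p : Coord (2 * m) → E) y (EuclideanSpace.single i 1) : E) ≠ 0 := by
  rw [fderiv_holoCoord hφ p hy i]
  intro h0
  apply coordField_ne_zero hφ i hy.1
  apply (mdifferentiable_chart (I := 𝓘(ℝ, E)) p).mfderiv_injective hy.2
  exact h0.trans (map_zero _).symm

/-- The ratio of the two coefficients of the `k`-th pair. -/
def ratio (g : SmoothMetric E M) (φ : OpenPartialHomeomorph M (Coord (2 * m))) (k : Fin m)
    (y : Coord (2 * m)) : ℝ :=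
  coeff g φ (fstIdx k) y / coeff g φ (sndIdx k) y

theorem ratio_ne_zero (hφ : IsSmoothChart (E := E) φ) (k : Fin m) {y : Coord (2 * m)}
    (hy : y ∈ φ.target) : ratio g φ k y ≠ 0 :=
  (div_pos (coeff_pos hφ _ hy) (coeff_pos hφ _ hy)).ne'

/-- The differential of a holomorphic chart commutes with `J`, and `J` sends the first field of a
pair to `ratio` times the second. -/
theorem IsUnitaryOrthogonalChart.fderiv_holoCoord_fst (h : IsUnitaryOrthogonalChart g φ) (p : M)
    {y : Coord (2 * m)} (hy : y ∈ holoDomain E φ p) (k : Fin m) :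
    Complex.I • (fderiv ℝ (holoCoord φ p : Coord (2 * m) → E) y
        (EuclideanSpace.single (fstIdx k) 1) : E) =
      ratio g φ k y • fderiv ℝ (holoCoord φ p : Coord (2 * m) → E) y
        (EuclideanSpace.single (sndIdx k) 1) := by
  rw [fderiv_holoCoord h.1.1 p hy, fderiv_holoCoord h.1.1 p hy]
  have h1 : MDifferentiableAt 𝓘(ℂ, E) 𝓘(ℂ, E) (chartAt E p) (φ.symm y) :=
    (mdifferentiable_chart (I := 𝓘(ℂ, E)) p).mdifferentiableAt hy.2
  have h2 := mfderiv_complexJ h1 (coordField E φ (fstIdx k) y)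
  rw [h.complexJ_coordField_fst k hy.1, map_smul] at h2
  exact h2.symm

/-- On a polydisc, a function of the `k`-th pair of coordinates is determined by its values on the
`k`-th slice through the center. -/
theorem DependsOnlyOnPair.apply_slice {k : Fin m} {f : Coord (2 * m) → ℝ}
    (hf : DependsOnlyOnPair φ k f) {y₀ y : Coord (2 * m)} {ε : ℝ}
    (hε : pairEquiv m ⁻¹' Metric.ball (pairEquiv m y₀) ε ⊆ φ.target)
    (hy : pairEquiv m y ∈ Metric.ball (pairEquiv m y₀) ε) :
    f (slice y₀ k (pairEquiv m y k)) = f y := by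
  refine hf _ ((convex_ball _ _).linear_preimage (pairEquiv m).toLinearMap) hε _
    (slice_mem_ball ?_) _ hy (slice_fst y₀ y k) (slice_snd y₀ y k)
  exact lt_of_le_of_lt (dist_le_pi_dist _ _ k) hy

/-- Each pair of coordinates is carried by a Riemann surface. -/
theorem IsUnitaryOrthogonalChart.exists_factor [CompleteSpace E]
    (h : IsUnitaryOrthogonalChart g φ) (p : M) {y₀ : Coord (2 * m)} {ε : ℝ} (hε₀ : 0 < ε)
    (hε : pairEquiv m ⁻¹' Metric.ball (pairEquiv m y₀) ε ⊆ holoDomain E φ p) (k : Fin m) :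
    ∃ (S : MetricRiemannSurface) (e : OpenPartialHomeomorph ℂ S.carrier) (W : ℂ → ℂ),
      pairEquiv m y₀ k ∈ e.source ∧ e.source ⊆ Metric.ball (pairEquiv m y₀ k) ε ∧
      e.target = Set.univ ∧
      (∀ u ∈ e.source, HasMFDerivAt 𝓘(ℝ, ℂ) 𝓘(ℝ, ℂ) e u (fderiv ℝ W u)) ∧
      (∀ u ∈ e.source, Complex.I * fderiv ℝ W u 1 =
        ratio g φ k (slice y₀ k u) * fderiv ℝ W u Complex.I) ∧
      ∀ u ∈ e.source, ∀ v w : ℂ,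
        S.metric.inner (e u) (fderiv ℝ W u v : ℂ) (fderiv ℝ W u w : ℂ) =
          sqCoeff g φ (fstIdx k) (slice y₀ k u) * (v.re * w.re +
            v.im / ratio g φ k (slice y₀ k u) * (w.im / ratio g φ k (slice y₀ k u))) := by
  have s := h.1.1
  have hmaps : Set.MapsTo (slice y₀ k) (Metric.ball (pairEquiv m y₀ k) ε) (holoDomain E φ p) :=
    fun u hu => hε (slice_mem_ball hu)
  have hy₀ : y₀ ∈ holoDomain E φ p := hε (Metric.mem_ball_self hε₀)
  -- A complex linear `ℓ` preserves the Beltrami equation; it is chosen so that `W_x ≠ 0` at the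
  -- center of the slice.
  obtain ⟨ℓ, hℓ⟩ := SeparatingDual.exists_ne_zero (R := ℂ)
    (fderiv_holoCoord_ne_zero s p hy₀ (fstIdx k))
  let W : ℂ → ℂ := fun u => ℓ (holoCoord φ p (slice y₀ k u))
  have hWd : ∀ u ∈ Metric.ball (pairEquiv m y₀ k) ε, ∀ v, fderiv ℝ W u v =
      ℓ (fderiv ℝ (holoCoord φ p : Coord (2 * m) → E) (slice y₀ k u)
        ((pairEquiv m).symm (Pi.single k v))) := by
    intro u hu v
    have h1 := (((contDiffOn_holoCoord s p).contDiffAt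
      ((isOpen_holoDomain p).mem_nhds (hmaps hu))).differentiableAt (by simp)).hasFDerivAt
    have h2 := (ℓ.restrictScalars ℝ).hasFDerivAt.comp u (h1.comp u (hasFDerivAt_slice y₀ k u))
    have h3 : HasFDerivAt W _ u := h2
    rw [h3.fderiv]
    rfl
  have hfst : (pairEquiv m).symm (Pi.single k 1) = EuclideanSpace.single (fstIdx k) 1 := by
    rw [← pairEquiv_single_fst, ContinuousLinearEquiv.symm_apply_apply]
  have hsnd : (pairEquiv m).symm (Pi.single k Complex.I) =
      EuclideanSpace.single (sndIdx k) 1 := by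
    rw [← pairEquiv_single_snd, ContinuousLinearEquiv.symm_apply_apply]
  have hJ : ∀ u ∈ Metric.ball (pairEquiv m y₀ k) ε, Complex.I * fderiv ℝ W u 1 =
      ratio g φ k (slice y₀ k u) * fderiv ℝ W u Complex.I := by
    intro u hu
    have h1 := congrArg ℓ (h.fderiv_holoCoord_fst p (hmaps hu) k)
    rw [map_smul, ← Complex.coe_smul, map_smul] at h1
    rw [hWd u hu, hWd u hu, hfst, hsnd]
    exact h1
  have hmem := Metric.mem_ball_self (x := pairEquiv m y₀ k) hε₀
  obtain ⟨S, e, h1, h2, h3, h4, h5⟩ := exists_conformal_chart Metric.isOpen_ball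
    hmem (W := W)
    (ℓ.restrictScalars ℝ |>.contDiff.comp_contDiffOn
      ((contDiffOn_holoCoord s p).comp (contDiff_slice y₀ k).contDiffOn hmaps))
    (ρ := fun u => ratio g φ k (slice y₀ k u))
    (A := fun u => sqCoeff g φ (fstIdx k) (slice y₀ k u))
    (fun u hu => ratio_ne_zero s k (hmaps hu).1)
    ((contDiffOn_sqCoeff s (fstIdx k)).comp (contDiff_slice y₀ k).contDiffOn
      fun u hu => (hmaps hu).1)
    (fun u hu => sqCoeff_pos s _ (hmaps hu).1) hJ
    (by rw [hWd _ hmem, hfst, slice_self]; exact hℓ)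
  exact ⟨S, e, W, h1, h2, h3, h4, fun u hu => hJ u (h2 hu), h5⟩

end LocalProduct

/-! ### Assembling the local product -/

theorem linearMap_ext_pairs {m : ℕ} {F : Type*} [AddCommGroup F] [Module ℝ F]
    {A B : Coord (2 * m) →ₗ[ℝ] F}
    (hf : ∀ k, A (EuclideanSpace.single (fstIdx k) 1) = B (EuclideanSpace.single (fstIdx k) 1))
    (hs : ∀ k, A (EuclideanSpace.single (sndIdx k) 1) = B (EuclideanSpace.single (sndIdx k) 1)) :
    A = B := by
  apply (EuclideanSpace.basisFun (Fin (2 * m)) ℝ).toBasis.ext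
  intro i
  obtain ⟨k, rfl | rfl⟩ := eq_fstIdx_or_sndIdx i
  · simpa using hf k
  · simpa using hs k

section LocalProduct

variable {E : Type*} [NormedAddCommGroup E] [NormedSpace ℂ E]
  {M : Type*} [TopologicalSpace M] [ChartedSpace E M]
  {m : ℕ} {φ : OpenPartialHomeomorph M (Coord (2 * m))}

/-- The `k`-th pair of coordinates, as a complex number. -/
def pairProj (m : ℕ) (k : Fin m) : Coord (2 * m) →L[ℝ] ℂ :=
  (ContinuousLinearMap.proj (R := ℝ) (φ := fun _ : Fin m => ℂ) k) ∘L
    (pairEquiv m).toContinuousLinearMap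

theorem IsSmoothChart.mfderiv_symm_mfderiv (hφ : IsSmoothChart (E := E) φ) {y : Coord (2 * m)}
    (hy : y ∈ φ.target) (v : TangentSpace 𝓘(ℝ, E) (φ.symm y)) :
    mfderiv 𝓘(ℝ, Coord (2 * m)) 𝓘(ℝ, E) φ.symm y
      (mfderiv 𝓘(ℝ, E) 𝓘(ℝ, Coord (2 * m)) φ (φ.symm y) v) = v := by
  have h := hφ.mdifferentiable.symm_comp_deriv (φ.map_target hy)
  rw [φ.right_inv hy] at h
  exact congrArg (fun L => L v) h

theorem IsSmoothChart.mfderiv_mfderiv_symm (hφ : IsSmoothChart (E := E) φ) {y : Coord (2 * m)}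
    (hy : y ∈ φ.target) (ξ : Coord (2 * m)) :
    mfderiv 𝓘(ℝ, E) 𝓘(ℝ, Coord (2 * m)) φ (φ.symm y)
      (mfderiv 𝓘(ℝ, Coord (2 * m)) 𝓘(ℝ, E) φ.symm y ξ) = ξ :=
  congrArg (fun L => L ξ) (hφ.mdifferentiable.comp_symm_deriv hy)

theorem hasMFDerivAt_pairEquiv_apply (hφ : IsSmoothChart (E := E) φ) {y : Coord (2 * m)}
    (hy : y ∈ φ.target) (k : Fin m) :
    HasMFDerivAt 𝓘(ℝ, E) 𝓘(ℝ, ℂ) (fun q => pairEquiv m (φ q) k) (φ.symm y)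
      (pairProj m k ∘L
        (mfderiv 𝓘(ℝ, E) 𝓘(ℝ, Coord (2 * m)) φ (φ.symm y) : E →L[ℝ] Coord (2 * m))) := by
  have h1 : HasFDerivAt (fun y : Coord (2 * m) => pairEquiv m y k) (pairProj m k)
      (φ (φ.symm y)) := (pairProj m k).hasFDerivAt
  exact h1.hasMFDerivAt.comp (φ.symm y)
    (hφ.mdifferentiable.mdifferentiableAt (φ.map_target hy)).hasMFDerivAt

variable [IsManifold 𝓘(ℂ, E) ω M] {g : SmoothMetric E M}

/-- A real-linear map on the tangent space that only sees the `k`-th pair of coordinates, through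
a map compatible with the complex structures, is complex linear. -/
theorem IsUnitaryOrthogonalChart.map_complexJ (h : IsUnitaryOrthogonalChart g φ)
    {y : Coord (2 * m)} (hy : y ∈ φ.target) (k : Fin m) {L : ℂ →L[ℝ] ℂ}
    (hL : Complex.I * L 1 = ratio g φ k y * L Complex.I)
    (v : TangentSpace 𝓘(ℝ, E) (φ.symm y)) :
    L (pairEquiv m (mfderiv 𝓘(ℝ, E) 𝓘(ℝ, Coord (2 * m)) φ (φ.symm y)
        (complexJ (φ.symm y) v) : Coord (2 * m)) k) =
      Complex.I * L (pairEquiv m (mfderiv 𝓘(ℝ, E) 𝓘(ℝ, Coord (2 * m)) φ (φ.symm y) v :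
        Coord (2 * m)) k) := by
  have s := h.1.1
  let dφ : E →L[ℝ] Coord (2 * m) := mfderiv 𝓘(ℝ, E) 𝓘(ℝ, Coord (2 * m)) φ (φ.symm y)
  let dψ : Coord (2 * m) →L[ℝ] E := mfderiv 𝓘(ℝ, Coord (2 * m)) 𝓘(ℝ, E) φ.symm y
  let J : E →L[ℝ] E := complexJ (φ.symm y)
  have hφψ : ∀ ξ, dφ (dψ ξ) = ξ := s.mfderiv_mfderiv_symm hy
  have hψφ : ∀ v, dψ (dφ v) = v := s.mfderiv_symm_mfderiv hy
  have hr : ratio g φ k y ≠ 0 := ratio_ne_zero s k hy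
  have hpf : ∀ l, pairProj m k (EuclideanSpace.single (fstIdx l) 1) =
      (Pi.single l 1 : Fin m → ℂ) k :=
    fun l => congrFun (pairEquiv_single_fst l) k
  have hps : ∀ l, pairProj m k (EuclideanSpace.single (sndIdx l) 1) =
      (Pi.single l Complex.I : Fin m → ℂ) k :=
    fun l => congrFun (pairEquiv_single_snd l) k
  have hJf : ∀ l, J (dψ (EuclideanSpace.single (fstIdx l) 1)) =
      ratio g φ l y • dψ (EuclideanSpace.single (sndIdx l) 1) :=
    fun l => h.complexJ_coordField_fst l hy
  have hJs : ∀ l, J (dψ (EuclideanSpace.single (sndIdx l) 1)) =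
      (-(ratio g φ l y)⁻¹) • dψ (EuclideanSpace.single (fstIdx l) 1) := fun l => by
    rw [ratio, inv_div]
    exact h.complexJ_coordField_snd l hy
  -- It suffices to compare on coordinate vectors. Those outside the `k`-th pair give zero on both
  -- sides because `J` preserves each pair.
  have key : ((L ∘L pairProj m k ∘L dφ ∘L J ∘L dψ : Coord (2 * m) →L[ℝ] ℂ) :
        Coord (2 * m) →ₗ[ℝ] ℂ) =
      (((ContinuousLinearMap.mul ℝ ℂ Complex.I) ∘L L ∘L pairProj m k ∘L dφ ∘L dψ :
        Coord (2 * m) →L[ℝ] ℂ) : Coord (2 * m) →ₗ[ℝ] ℂ) := by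
    apply linearMap_ext_pairs
    · intro l
      simp only [ContinuousLinearMap.coe_coe, ContinuousLinearMap.comp_apply, hJf, map_smul, hφψ,
        hpf, hps, ContinuousLinearMap.mul_apply']
      by_cases e : l = k
      · subst e
        simp [hL]
      · simp [Pi.single_eq_of_ne (Ne.symm e)]
    · intro l
      simp only [ContinuousLinearMap.coe_coe, ContinuousLinearMap.comp_apply, hJs, map_smul, hφψ,
        hpf, hps, ContinuousLinearMap.mul_apply']
      by_cases e : l = k
      · subst e
        have h1 : L Complex.I = Complex.I * L 1 / ratio g φ l y := by
          rw [hL, mul_div_cancel_left₀ _ (Complex.ofReal_ne_zero.2 hr)]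
        rw [Pi.single_eq_same, Pi.single_eq_same, h1, Complex.real_smul]
        push_cast
        linear_combination (-(L 1) / (ratio g φ l y : ℂ)) * Complex.I_mul_I
      · simp [Pi.single_eq_of_ne (Ne.symm e)]
  have h2 : ∀ v : E, L (pairProj m k (dφ (J v))) = Complex.I * L (pairProj m k (dφ v)) := by
    intro v
    have h3 := LinearMap.congr_fun key (dφ v)
    simpa only [ContinuousLinearMap.coe_coe, ContinuousLinearMap.comp_apply, hψφ,
      ContinuousLinearMap.mul_apply'] using h3
  exact h2 v

/-- The factor maps are built only on the slices through `φ p`. The Kähler condition enters through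
the dependence of the coefficients on their own pair, which carries the slice identities to nearby
points. -/
theorem IsUnitaryOrthogonalChart.exists_productIsometry [FiniteDimensional ℂ E]
    (h : IsUnitaryOrthogonalChart g φ) (hg : IsKahler g) {p : M} (hp : p ∈ φ.source) :
    ∃ (S : Fin m → MetricRiemannSurface)
      (Φ : OpenPartialHomeomorph M (Π k, (S k).carrier)),
      p ∈ Φ.source ∧ IsProductIsometry g S Φ := by
  have : CompleteSpace E := FiniteDimensional.complete ℂ E
  have s := h.1.1
  -- In the sup norm of `ℂᵐ` the ball is a polydisc: it is convex, as `DependsOnlyOnPair` requires,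
  -- and a product of discs, so the sources of the factor charts can be chosen independently.
  obtain ⟨ε, hε₀, hε⟩ : ∃ ε > 0, pairEquiv m ⁻¹' Metric.ball (pairEquiv m (φ p)) ε ⊆
      holoDomain E φ p := by
    have h1 : IsOpen ((pairEquiv m).symm ⁻¹' holoDomain E φ p) :=
      (isOpen_holoDomain p).preimage (pairEquiv m).symm.continuous
    obtain ⟨ε, hε₀, hε⟩ := Metric.isOpen_iff.1 h1 (pairEquiv m (φ p)) (by
      rw [Set.mem_preimage, ContinuousLinearEquiv.symm_apply_apply]
      refine ⟨φ.map_source hp, ?_⟩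
      rw [Set.mem_preimage, φ.left_inv hp]
      exact mem_chart_source E p)
    refine ⟨ε, hε₀, fun y hy => ?_⟩
    have h2 := hε hy
    rwa [Set.mem_preimage, ContinuousLinearEquiv.symm_apply_apply] at h2
  choose S e W he₀ heb het hed heJ hei using h.exists_factor p hε₀ hε
  let Φ : OpenPartialHomeomorph M (Π k, (S k).carrier) :=
    (φ.trans (pairEquiv m).toHomeomorph.toOpenPartialHomeomorph).trans (OpenPartialHomeomorph.pi e)
  have hsource : ∀ q, q ∈ Φ.source ↔ q ∈ φ.source ∧ ∀ k, pairEquiv m (φ q) k ∈ (e k).source := by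
    intro q
    simp [Φ]
  have hball : ∀ u : Fin m → ℂ, (∀ k, u k ∈ (e k).source) →
      u ∈ Metric.ball (pairEquiv m (φ p)) ε := fun u hu =>
    (dist_pi_lt_iff hε₀).2 fun k => heb k (hu k)
  have hdom : ∀ q ∈ Φ.source, ∃ y ∈ φ.target, φ.symm y = q ∧
      ∀ k, pairEquiv m y k ∈ (e k).source := fun q hq =>
    ⟨φ q, φ.map_source ((hsource q).1 hq).1, φ.left_inv ((hsource q).1 hq).1, ((hsource q).1 hq).2⟩
  have hderiv : ∀ y ∈ φ.target, (∀ k, pairEquiv m y k ∈ (e k).source) → ∀ k,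
      HasMFDerivAt 𝓘(ℝ, E) 𝓘(ℝ, ℂ) (fun q => Φ q k) (φ.symm y)
        ((fderiv ℝ (W k) (pairEquiv m y k)) ∘L
          pairProj m k ∘L
          (mfderiv 𝓘(ℝ, E) 𝓘(ℝ, Coord (2 * m)) φ (φ.symm y) : E →L[ℝ] Coord (2 * m))) := by
    intro y hy hye k
    have h1 := hed k _ (hye k)
    have h2 := hasMFDerivAt_pairEquiv_apply s hy k
    rw [← φ.right_inv hy] at h1
    have h3 := h1.comp (φ.symm y) h2
    rw [φ.right_inv hy] at h3
    exact h3
  have hdep : ∀ {f : Coord (2 * m) → ℝ} {k : Fin m}, DependsOnlyOnPair φ k f →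
      ∀ y, (∀ k, pairEquiv m y k ∈ (e k).source) → f (slice (φ p) k (pairEquiv m y k)) = f y :=
    fun hf y hye => hf.apply_slice (hε.trans Set.inter_subset_left) (hball _ hye)
  have hratio : ∀ (k : Fin m) y, (∀ k, pairEquiv m y k ∈ (e k).source) →
      ratio g φ k (slice (φ p) k (pairEquiv m y k)) = ratio g φ k y := by
    intro k y hye
    rw [ratio, ratio, hdep (h.dependsOnlyOnPair_coeff hg (Or.inl rfl)) y hye,
      hdep (h.dependsOnlyOnPair_coeff hg (Or.inr rfl)) y hye]
  refine ⟨S, Φ, (hsource p).2 ⟨hp, he₀⟩, ?_, ?_, ?_⟩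
  · rw [Set.eq_univ_iff_forall]
    intro x
    have h1 : ∀ k, (e k).symm (x k) ∈ (e k).source := fun k =>
      (e k).map_target (het k ▸ Set.mem_univ _)
    have h2 : ∀ k, x k ∈ (e k).target := fun k => het k ▸ Set.mem_univ _
    have h3 : (pairEquiv m).symm (fun k => (e k).symm (x k)) ∈ φ.target := by
      refine (hε ?_).1
      rw [Set.mem_preimage, ContinuousLinearEquiv.apply_symm_apply]
      exact hball _ h1
    exact ⟨fun k _ => h2 k, Set.mem_univ _, h3⟩
  · intro k q hq
    obtain ⟨y, hy, rfl, hye⟩ := hdom q hq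
    have h1 := hderiv y hy hye k
    refine MDifferentiableAt.mdifferentiableWithinAt
      (mdifferentiableAt_complex_of_real h1.mdifferentiableAt fun v => ?_)
    rw [h1.mfderiv]
    have h2 := heJ k _ (hye k)
    -- The Beltrami equation was known with the ratio on the slice; it now holds with the ratio at
    -- `y`, which makes the differential complex linear there.
    rw [hratio k y hye] at h2
    exact h.map_complexJ hy k h2 v
  · intro q hq v w
    obtain ⟨y, hy, rfl, hye⟩ := hdom q hq
    have h1 := h.1.inner_mfderiv_symm hy
      (mfderiv 𝓘(ℝ, E) 𝓘(ℝ, Coord (2 * m)) φ (φ.symm y) v)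
      (mfderiv 𝓘(ℝ, E) 𝓘(ℝ, Coord (2 * m)) φ (φ.symm y) w)
    rw [s.mfderiv_symm_mfderiv hy, s.mfderiv_symm_mfderiv hy] at h1
    rw [h1, sum_eq_sum_pairs]
    refine Finset.sum_congr rfl fun k _ => ?_
    rw [(hderiv y hy hye k).mfderiv]
    have h2 : Φ (φ.symm y) k = e k (pairEquiv m y k) := by
      change e k (pairEquiv m (φ (φ.symm y)) k) = _
      rw [φ.right_inv hy]
    have hr := ratio_ne_zero (g := g) s k hy
    -- The base point is generalized because the tangent space depends on it, so `h2` cannot simply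
    -- be rewritten.
    have h3 : ∀ x, x = e k (pairEquiv m y k) → ∀ ξ η : ℂ,
        (S k).metric.inner x (fderiv ℝ (W k) (pairEquiv m y k) ξ : ℂ)
          (fderiv ℝ (W k) (pairEquiv m y k) η : ℂ) =
        sqCoeff g φ (fstIdx k) y * (ξ.re * η.re) + sqCoeff g φ (sndIdx k) y * (ξ.im * η.im) := by
      rintro x rfl ξ η
      refine (hei k _ (hye k) ξ η).trans ?_
      rw [hratio k y hye, hdep (h.dependsOnlyOnPair_sqCoeff hg (Or.inl rfl)) y hye, ratio,
        ← coeff_sq s _ hy, ← coeff_sq s _ hy]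
      have h4 := (coeff_pos (g := g) s (fstIdx k) hy).ne'
      have h5 := (coeff_pos (g := g) s (sndIdx k) hy).ne'
      -- What is left is `a_{2k+1}² / ρ² = a_{2k+2}²`.
      field_simp
    exact (h3 _ h2
      (pairProj m k (mfderiv 𝓘(ℝ, E) 𝓘(ℝ, Coord (2 * m)) φ (φ.symm y) v))
      (pairProj m k (mfderiv 𝓘(ℝ, E) 𝓘(ℝ, Coord (2 * m)) φ (φ.symm y) w))).symm

end LocalProduct

end KahlerOrthogonal
end

open KahlerOrthogonal in
theorem mainTheorem3 {m : ℕ} {E : Type*} [NormedAddCommGroup E] [NormedSpace ℂ E]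
    [FiniteDimensional ℂ E] (hE : Module.finrank ℂ E = m)
    {M : Type*} [TopologicalSpace M] [T2Space M] [ChartedSpace E M] [IsManifold 𝓘(ℂ, E) ω M]
    (g : SmoothMetric E M) (hg : IsKahler g) :
    (∀ φ : OpenPartialHomeomorph M (Coord (2 * m)), IsUnitaryOrthogonalChart g φ →
      ∀ k : Fin m, DependsOnlyOnPair φ k (coeff g φ (fstIdx k)) ∧
        DependsOnlyOnPair φ k (coeff g φ (sndIdx k))) ∧
    (SupportsUnitaryOrthogonalCoordinates m g → IsLocallyProductOfRiemannSurfaces m g) := by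
  refine ⟨fun φ h k => ⟨h.dependsOnlyOnPair_coeff hg (Or.inl rfl),
    h.dependsOnlyOnPair_coeff hg (Or.inr rfl)⟩, fun h p => ?_⟩
  obtain ⟨φ, hp, hφ⟩ := h p
  exact hφ.exists_productIsometry hg hp
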